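/- Let $q$ be a power of a prime $p$, let $\mathcal X$ be a projective, geometrically irreducible, nonsingular algebraic curve defined over $\mathbb F_q$, let $u,m$ be coprime integers with $m>u\ge 1$, let $n\ge 2$, and let $\phi=(f_0:\cdots:f_n):\mathcal X\to\mathbb P^n(\overline{\mathbb F}_q)$ be a nondegenerate morphism defined over $\mathbb F_q$ (that is, $f_0,\dots,f_n\in\mathbb F_q(\mathcal X)$ are linearly independent over $\overline{\mathbb F}_q$). For a point $P\in\mathcal X$ (over $\overline{\mathbb F}_q$) let $v_P$ be its discrete valuation, $e_P=-\min_i v_P(f_i)$, $E=\sum_P e_P P$, and let $\mathcal D=\{\operatorname{div}(\sum_i a_if_i)+E : (a_0:\cdots:a_n)\in\mathbb P^n(\overline{\mathbb F}_q)\}$ be the linear series of $\phi$; the $(\mathcal D,P)$-orders $j_0<j_1<\cdots<j_n$ are the integers $v_P(D)$ with $D\in\mathcal D$. Let $t\in\mathbb F_q(\mathcal X)$ be a separating variable, let $D_t^{(i)}$ be the $i$-th Hasse derivative with respect to $t$, and for non-negative integers $\rho_0,\dots,\rho_{n-2}$ let $\mathcal A_t^{\rho_0,\dots,\rho_{n-2}}$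 be the determinant of the $(n+1)\times(n+1)$ matrix with rows $(f_i^{q^m})_{0\le i\le n}$, $(f_i^{q^u})_{0\le i\le n}$, $(D_t^{(\rho_0)}f_i)_{0\le i\le n},\dots,(D_t^{(\rho_{n-2})}f_i)_{0\le i\le n}$. Let $(\kappa_0,\dots,\kappa_{n-2})$ be the lexicographically least sequence with $0\le\kappa_0<\cdots<\kappa_{n-2}$ and $\mathcal A_t^{\kappa_0,\dots,\kappa_{n-2}}\ne 0$, and let $$T_{u,m}=\operatorname{div}\bigl(\mathcal A_t^{\kappa_0,\dots,\kappa_{n-2}}\bigr)+(\kappa_0+\cdots+\kappa_{n-2})\operatorname{div}(dt)+(q^m+q^u+n-1)E .$$ Let $P\in\mathcal X$ have $(\mathcal D,P)$-orders $j_0,\dots,j_n$. Then $$v_P(T_{u,m})\ \ge\ \begin{cases} j_1q^u+\sum_{i=0}^{n-2}(j_{i+2}-\kappa_i) & \text{if } P\in\mathcal X(\mathbb F_q), & (1)\\ j_1q^u+\sum_{i=0}^{n-2}(j_i-\kappa_i) & \text{if } P\in\mathcal X(\mathbb F_{q^{m-u}}), & (2)\\ \sum_{i=1}^{n-1}(j_i-\kappa_{i-1})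 & \text{if } P\in\mathcal X(\mathbb F_{q^u})\text{ or }P\in\mathcal X(\mathbb F_{q^m}), & (3)\\ \sum_{i=0}^{n-2}(j_i-\kappa_i) & \text{for every } P\in\mathcal X. & (4)\end{cases}$$ In addition: (i) for $P\in\mathcal X(\mathbb F_q)$, equality holds in (1) if and only if $p\nmid\det\left(\binom{j_i}{\kappa_s}\right)_{2\le i\le n,\ 0\le s\le n-2}$; (ii) if $p\mid\det\left(\binom{j_i}{\kappa_s}\right)_{1\le i\le n-1,\ 0\le s\le n-2}$, then the inequality (3) is strict for $P\in\mathcal X(\mathbb F_{q^u})$ and for $P\in\mathcal X(\mathbb F_{q^m})$; (iii) if $p\mid\det\left(\binom{j_i}{\kappa_s}\right)_{0\le i,s\le n-2}$, then the inequality (4) is strict, and so is (2) for $P\in\mathcal X(\mathbb F_{q^{m-u}})$. -/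

import Mathlib

open scoped KaehlerDifferential

namespace FrobeniusDivisor

noncomputable section

/-- `L / F` is an algebraic function field of one variable: `L` is a finite extension of `F(x)`
for some `x` transcendental over `F`. -/
def IsFunctionFieldOneVar (F L : Type*) [Field F] [Field L] [Algebra F L] : Prop :=
  ∃ x : L, Transcendental F x ∧ FiniteDimensional (IntermediateField.adjoin F {x}) L

/-- `t` is a separating variable of `L / F`: `L` is a separable algebraic extension of `F(t)`. -/
def IsSeparatingVariable (F : Type*) {L : Type*} [Field F] [Field L] [Algebra F L] (t : L) :
    Prop :=
  Algebra.IsSeparable (IntermediateField.adjoin F {t}) L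

/-- A point of the nonsingular projective curve over the algebraically closed field `k` with
function field `K`, given by its normalized discrete valuation `v : K → ℤ ∪ {∞}`, trivial on the
constants. -/
structure Place (k K : Type*) [Field k] [Field K] [Algebra k K] where
  /-- the discrete valuation at the point -/
  v : AddValuation K (WithTop ℤ)
  v_algebraMap : ∀ c : k, c ≠ 0 → v (algebraMap k K c) = 0
  exists_uniformizer : ∃ s : K, v s = 1

section

variable {k K : Type*} [Field k] [Field K] [Algebra k K]

/-- The valuation at `P` as an integer (only meaningful for `g ≠ 0`). -/
def Place.ord (P : Place k K) (g : K) : ℤ := (P.v g).untopD 0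

/-- A local parameter at `P`. -/
def Place.uniformizer (P : Place k K) : K := P.exists_uniformizer.choose

/-- The order at `P` of a nonzero differential `ω`: write `ω = h ds` with `s` a local parameter
at `P`; the order is `v_P(h)`. -/
def Place.ordDiff (P : Place k K) (ω : Ω[K⁄k]) : ℤ :=
  P.ord (Classical.epsilon fun h : K => ω = h • KaehlerDifferential.D k K P.uniformizer)

/-- `P` is an `𝔽_{q^d}`-rational point, where `q = #F` and `L` is the function field over `F`:
every function defined over `F` and regular at `P` takes at `P` a value in
`𝔽_{q^d} = {c ∈ k | c ^ (q ^ d) = c}`. -/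
def Place.IsRational (P : Place k K) (F L : Type*) [Field L] [Algebra L K] (d : ℕ) : Prop :=
  ∀ g : L, 0 ≤ P.v (algebraMap L K g) →
    ∃ c : k, c ^ (Nat.card F ^ d) = c ∧ 0 < P.v (algebraMap L K g - algebraMap k K c)

/-- `D` is the system of Hasse derivatives with respect to `t`: the higher derivation of
`K / k` with `D⁽¹⁾ t = 1` and `D⁽ⁱ⁾ t = 0` for `i ≥ 2`. -/
structure IsHasseSystem (t : K) (D : ℕ → K →ₗ[k] K) : Prop where
  zero : D 0 = LinearMap.id
  leibniz : ∀ (i : ℕ) (x y : K),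
    D i (x * y) = ∑ ab ∈ Finset.HasAntidiagonal.antidiagonal i, D ab.1 x * D ab.2 y
  one_var : D 1 t = 1
  var : ∀ i : ℕ, 2 ≤ i → D i t = 0

open Classical in
/-- The `i`-th Hasse derivative `D_t^{(i)}` on `K / k`. For a separating variable `t` the system
of Hasse derivatives exists and is unique. -/
def hasseDeriv (k : Type*) {K : Type*} [Field k] [Field K] [Algebra k K] (t : K) (i : ℕ) :
    K →ₗ[k] K :=
  if h : ∃ D : ℕ → K →ₗ[k] K, IsHasseSystem t D then h.choose i else 0

/-- `e_P = - min {v_P(f_0), …, v_P(f_n)}`. -/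
def baseOrder {ι : Type*} [Fintype ι] (f : ι → K) (P : Place k K) : ℤ :=
  -((Finset.univ.inf fun i => P.v (f i)).untopD 0)

/-- The linear series `{div(∑ aᵢ fᵢ) + E | a ≠ 0}` of the morphism `(f_0 : ⋯ : f_n)`, where
`E = ∑ e_P P`; a divisor is given by its multiplicity at every point. -/
def linearSeries (k : Type*) {K ι : Type*} [Field k] [Field K] [Algebra k K] [Fintype ι]
    (f : ι → K) : Set (Place k K → ℤ) :=
  {E | ∃ a : ι → k, a ≠ 0 ∧ E = fun P => P.ord (∑ i, a i • f i) + baseOrder f P}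

/-- `j_0 < ⋯ < j_n` are the `(𝒟, P)`-orders, for `𝒟` the linear series of `(f_0 : ⋯ : f_n)`. -/
def IsOrderSeqAt {N : ℕ} (f : Fin N → K) (P : Place k K) (j : Fin N → ℕ) : Prop :=
  StrictMono j ∧
    Set.range (fun i => (j i : ℤ)) = {e : ℤ | ∃ E ∈ linearSeries k f, E P = e}

/-- The determinant `𝒜_t^{ρ_0, …, ρ_{n-2}}(f_0, …, f_n)`, with `n = r + 1`: its rows are
`f^{q^m}`, `f^{q^u}` and `D_t^{(ρ_s)} f` for `s = 0, …, n - 2`. -/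
def frobeniusDet (k : Type*) {K : Type*} [Field k] [Field K] [Algebra k K] (q u m : ℕ) {r : ℕ}
    (t : K) (f : Fin (r + 2) → K) (ρ : Fin r → ℕ) : K :=
  Matrix.det (Matrix.of
    (Matrix.vecCons (fun i => f i ^ q ^ m)
      (Matrix.vecCons (fun i => f i ^ q ^ u)
        (fun (s : Fin r) (i : Fin (r + 2)) => hasseDeriv k t (ρ s) (f i)))))

/-- `κ` is the `(q^u, q^m)`-Frobenius order-sequence: the lexicographically least among the
strictly increasing sequences `ρ` with `𝒜_t^ρ(f) ≠ 0`. -/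
def IsFrobeniusOrderSeq (k : Type*) {K : Type*} [Field k] [Field K] [Algebra k K] (q u m : ℕ)
    {r : ℕ} (t : K) (f : Fin (r + 2) → K) (κ : Fin r → ℕ) : Prop :=
  IsLeast {ρ : Lex (Fin r → ℕ) | StrictMono (ofLex ρ) ∧ frobeniusDet k q u m t f (ofLex ρ) ≠ 0}
    (toLex κ)

/-- The `(q^u, q^m)`-Frobenius divisor `T_{u,m}`, through its multiplicity at every point:
`div(𝒜_t^κ(f)) + (κ_0 + ⋯ + κ_{n-2}) div(dt) + (q^m + q^u + n - 1) E`, with `n = r + 1`. -/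
def frobeniusDivisor (q u m : ℕ) {r : ℕ} (t : K) (f : Fin (r + 2) → K) (κ : Fin r → ℕ)
    (P : Place k K) : ℤ :=
  P.ord (frobeniusDet k q u m t f κ)
    + (∑ s, (κ s : ℤ)) * P.ordDiff (KaehlerDifferential.D k K t)
    + ((q : ℤ) ^ m + (q : ℤ) ^ u + (r : ℤ)) * baseOrder f P

end

/-- The integer determinant `det (binom (a i) (κ s))`. -/
def binomDet {r : ℕ} (a κ : Fin r → ℕ) : ℤ :=
  Matrix.det (Matrix.of fun i s : Fin r => ((a i).choose (κ s) : ℤ))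

end

end FrobeniusDivisor

/-! The multiplicity of T_{u,m} at P is the order of a single determinant of power series. Let s be
a local parameter at P, g the inverse of an f_i of least valuation, and φ_i the expansion of g·f_i
in s. Passing from t to s acts on Hasse derivatives by a triangular matrix, and the minimality of κ
kills every off-diagonal contribution. So the determinant is multiplied exactly by (dt/ds)^{Σκ} ·
g^{q^m+q^u+n-1}, which is what the correction terms in T_{u,m} record (`algebraMap_det_expand`,
`X_pow_dvd_expandDet_iff`).

Over k the φ_i may be replaced by combinations G_c = Σ b_{ci} φ_i of orders j_c. Once multiplied by
s^l, the l-th Hasse derivative of G_c starts with binom(j_c, l) s^{j_c}, up to the leading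
coefficient of G_c. A minor on the derivative rows thus has a multiple of a binomial determinant as
its lowest coefficient, and Laplace expansion along the two Frobenius rows reduces each bound to
minimizing a weight over pairs of deleted columns (`X_pow_dvd_det_general`, `X_pow_dvd_det_middle`,
`X_pow_dvd_det_rational`). The bound is strict when p divides the binomial determinant of the
minimizing columns. Over 𝔽_q the minimum is attained only once, with exact orders in both Frobenius
rows, whence an equivalence.

The Frobenius rows become Σ b_{ci} φ_i^{q^d}, which are not powers of G_c because the b_{ci} are
arbitrary constants. At a point rational over 𝔽_{q^d} their order is nevertheless q^d·j_c: the
automorphism of K fixing L and raising constants to the power q^d sends the entry to G_c^{q^d}, and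
it preserves v_P (`v_constFrob`). At a point over 𝔽_{q^{m-u}} the two Frobenius rows are subtracted
instead: φ_i − φ_i(P) belongs to the linear series, so it vanishes to order at least j_1, and
φ_i^{q^m} − φ_i^{q^u} is divisible by s^{j_1 q^u}. -/

namespace FrobeniusDivisor

noncomputable section

/-! ### Valuations and residues at a place -/

namespace Place

section Basic

variable {k K : Type*} [Field k] [Field K] [Algebra k K] (P : Place k K)

theorem v_uniformizer : P.v P.uniformizer = 1 := P.exists_uniformizer.choose_spec

theorem uniformizer_ne_zero : P.uniformizer ≠ 0 := by
  intro h
  have := P.v_uniformizer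
  rw [h, AddValuation.map_zero] at this
  exact absurd this (by decide)

theorem v_ne_top {x : K} (hx : x ≠ 0) : P.v x ≠ ⊤ := by
  rwa [Ne, AddValuation.top_iff]

theorem v_eq_ord {x : K} (hx : x ≠ 0) : P.v x = (P.ord x : ℤ) := by
  obtain ⟨n, hn⟩ := WithTop.ne_top_iff_exists.1 (P.v_ne_top hx)
  rw [ord, ← hn, WithTop.untopD_coe]

theorem ord_mul {x y : K} (hx : x ≠ 0) (hy : y ≠ 0) : P.ord (x * y) = P.ord x + P.ord y := by
  have h := P.v.map_mul x y
  rw [P.v_eq_ord hx, P.v_eq_ord hy, P.v_eq_ord (mul_ne_zero hx hy)] at h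
  exact_mod_cast h

theorem ord_pow {x : K} (hx : x ≠ 0) (n : ℕ) : P.ord (x ^ n) = n * P.ord x := by
  induction n with
  | zero =>
    have h := P.v.map_one
    rw [P.v_eq_ord one_ne_zero] at h
    have h' : P.ord (1 : K) = 0 := by exact_mod_cast h
    simp [h']
  | succ n ih =>
    rw [pow_succ, P.ord_mul (pow_ne_zero n hx) hx, ih]
    push_cast
    ring

theorem ord_inv {x : K} (hx : x ≠ 0) : P.ord x⁻¹ = - P.ord x := by
  have h := P.ord_mul hx (inv_ne_zero hx)
  rw [mul_inv_cancel₀ hx] at h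
  have h1 := P.ord_pow hx 0
  simp only [pow_zero, Nat.cast_zero, zero_mul] at h1
  omega

theorem ord_uniformizer : P.ord P.uniformizer = 1 := by
  have h := P.v_uniformizer
  rw [P.v_eq_ord P.uniformizer_ne_zero] at h
  exact_mod_cast h

theorem zero_le_v_algebraMap (c : k) : 0 ≤ P.v (algebraMap k K c) := by
  by_cases hc : c = 0
  · simp [hc]
  · rw [P.v_algebraMap c hc]

theorem eq_zero_of_v_algebraMap_pos {c : k} (hc : 0 < P.v (algebraMap k K c)) : c = 0 := by
  by_contra h
  rw [P.v_algebraMap c h] at hc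
  exact lt_irrefl _ hc

theorem le_v_mul {x y : K} {a b : WithTop ℤ} (hx : a ≤ P.v x) (hy : b ≤ P.v y) :
    a + b ≤ P.v (x * y) := by
  rw [AddValuation.map_mul]; exact add_le_add hx hy

theorem v_pow_pos {x : K} (hx : 0 < P.v x) {n : ℕ} (hn : n ≠ 0) : 0 < P.v (x ^ n) := by
  obtain ⟨n, rfl⟩ := Nat.exists_eq_succ_of_ne_zero hn
  rw [pow_succ, AddValuation.map_mul]
  refine lt_of_lt_of_le hx ?_
  refine le_add_of_nonneg_left ?_
  rw [AddValuation.map_pow]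
  exact nsmul_nonneg hx.le n

theorem zero_le_v_pow {x : K} (hx : 0 ≤ P.v x) (n : ℕ) : 0 ≤ P.v (x ^ n) := by
  rw [AddValuation.map_pow]
  exact nsmul_nonneg hx n

theorem zero_le_v_mul {x y : K} (hx : 0 ≤ P.v x) (hy : 0 ≤ P.v y) : 0 ≤ P.v (x * y) := by
  simpa using P.le_v_mul hx hy

theorem v_mul_pos {x y : K} (hx : 0 ≤ P.v x) (hy : 0 < P.v y) : 0 < P.v (x * y) := by
  rw [AddValuation.map_mul]
  exact lt_of_lt_of_le hy (le_add_of_nonneg_left hx)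

theorem v_sum_pos {ι : Type*} (s : Finset ι) (g : ι → K) (h : ∀ i ∈ s, 0 < P.v (g i)) :
    0 < P.v (∑ i ∈ s, g i) :=
  AddValuation.map_lt_sum' P.v (by exact WithTop.coe_lt_top 0) h

theorem v_inv_of_v_eq_zero {x : K} (hx : P.v x = 0) : P.v x⁻¹ = 0 := by
  have h0 : x ≠ 0 := by
    rintro rfl
    rw [AddValuation.map_zero] at hx
    exact absurd hx (by decide)
  have := P.v.map_mul x x⁻¹
  rw [mul_inv_cancel₀ h0, AddValuation.map_one, hx, zero_add] at this
  exact this.symm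

theorem v_add_eq_zero {x y : K} (hx : P.v x = 0) (hy : 0 < P.v y) : P.v (x + y) = 0 := by
  rw [AddValuation.map_add_eq_of_lt_left P.v (by rwa [hx]), hx]

/-- The valuation ring of a place. -/
def valRing : ValuationSubring K where
  carrier := {x | 0 ≤ P.v x}
  mul_mem' := fun hx hy => P.zero_le_v_mul hx hy
  one_mem' := by simp
  add_mem' := fun hx hy => AddValuation.map_le_add P.v hx hy
  zero_mem' := by simp
  neg_mem' := fun {x} hx => by simpa [AddValuation.map_neg] using hx
  mem_or_inv_mem' := fun x => by
    by_cases hx : x = 0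
    · simp [hx]
    · simp only [Set.mem_ofPred_eq, P.v_eq_ord hx, P.v_eq_ord (inv_ne_zero hx), P.ord_inv hx]
      norm_cast
      omega

theorem mem_valRing {x : K} : x ∈ P.valRing ↔ 0 ≤ P.v x := Iff.rfl

/-- A root c of h splits off a factor X − c. Either x − c vanishes at the point, or it is a unit
there and the cofactor, of smaller degree, still takes a value of positive valuation. -/
theorem exists_residue_of_v_aeval_pos [IsAlgClosed k] {x : K} (hx : 0 ≤ P.v x) (h : Polynomial k)
    (h0 : h ≠ 0) (hv : 0 < P.v (Polynomial.aeval x h)) :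
    ∃ c : k, 0 < P.v (x - algebraMap k K c) := by
  induction hn : h.natDegree using Nat.strong_induction_on generalizing h with
  | _ n ih =>
    by_cases hd : h.degree = 0
    · rw [Polynomial.eq_C_of_degree_eq_zero hd, Polynomial.aeval_C] at hv
      have := P.eq_zero_of_v_algebraMap_pos hv
      rw [Polynomial.eq_C_of_degree_eq_zero hd, this] at h0
      simp at h0
    · obtain ⟨c, hc⟩ := IsAlgClosed.exists_root h hd
      obtain ⟨g, rfl⟩ := Polynomial.dvd_iff_isRoot.2 hc
      have hg : g ≠ 0 := right_ne_zero_of_mul h0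
      by_cases hxc : 0 < P.v (x - algebraMap k K c)
      · exact ⟨c, hxc⟩
      · refine ih g.natDegree ?_ g hg ?_ rfl
        · rw [← hn, Polynomial.natDegree_mul (Polynomial.X_sub_C_ne_zero c) hg,
            Polynomial.natDegree_X_sub_C]
          omega
        · have hxc0 : P.v (x - algebraMap k K c) = 0 :=
            le_antisymm (not_lt.1 hxc) (AddValuation.map_le_sub P.v hx (P.zero_le_v_algebraMap c))
          simpa [AddValuation.map_mul, hxc0] using hv

/-- A regular function is a constant plus a function vanishing at the point, provided that the
function field has transcendence degree at most one. -/
theorem exists_residue [IsAlgClosed k] (htr : Algebra.trdeg k K ≤ 1) {x : K}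
    (hx : 0 ≤ P.v x) : ∃ c : k, 0 < P.v (x - algebraMap k K c) := by
  by_cases hxa : IsAlgebraic k x
  · obtain ⟨h, h0, hh⟩ := hxa
    refine P.exists_residue_of_v_aeval_pos hx h h0 ?_
    rw [hh, AddValuation.map_zero]
    exact WithTop.coe_lt_top 0
  have hind : AlgebraicIndependent k (fun _ : Unit => x) :=
    (algebraicIndependent_unique_type_iff).2 hxa
  have hbasis : IsTranscendenceBasis k (fun _ : Unit => x) := by
    refine hind.isTranscendenceBasis_of_lift_trdeg_le_of_finite ?_
    simpa using htr
  have halg := hbasis.isAlgebraic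
  -- The uniformizer is algebraic over k[x]. In a relation with nonzero constant term, that term is
  -- minus a multiple of the uniformizer, hence a nonzero polynomial in x of positive valuation.
  obtain ⟨H, hH, hHs⟩ := (halg.isAlgebraic P.uniformizer).exists_nonzero_coeff_and_aeval_eq_zero
    (mem_nonZeroDivisors_of_ne_zero P.uniformizer_ne_zero)
  have hmem : ∀ a : Algebra.adjoin k (Set.range fun _ : Unit => x),
      ∃ h : Polynomial k, Polynomial.aeval x h = (a : K) := by
    rintro ⟨a, ha⟩
    rw [Set.range_const, Algebra.adjoin_singleton_eq_range_aeval] at ha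
    exact ha
  have hreg : ∀ a : Algebra.adjoin k (Set.range fun _ : Unit => x), 0 ≤ P.v (a : K) := by
    intro a
    obtain ⟨h, hh⟩ := hmem a
    rw [← hh, Polynomial.aeval_eq_sum_range]
    refine AddValuation.map_le_sum P.v fun i _ => ?_
    rw [Algebra.smul_def]
    exact P.zero_le_v_mul (P.zero_le_v_algebraMap _) (P.zero_le_v_pow hx _)
  obtain ⟨h, hh⟩ := hmem (H.coeff 0)
  refine P.exists_residue_of_v_aeval_pos hx h ?_ ?_
  · rintro rfl
    rw [map_zero] at hh
    exact hH (Subtype.ext hh.symm)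
  · have hs : 0 < P.v P.uniformizer := by rw [P.v_uniformizer]; decide
    have hdiv : 0 ≤ P.v (Polynomial.aeval P.uniformizer H.divX) := by
      rw [Polynomial.aeval_eq_sum_range]
      refine AddValuation.map_le_sum P.v fun i _ => ?_
      rw [Algebra.smul_def]
      exact P.zero_le_v_mul (hreg _) (P.zero_le_v_pow hs.le _)
    have hsplit := congrArg (Polynomial.aeval P.uniformizer) H.divX_mul_X_add
    rw [hHs, map_add, map_mul, Polynomial.aeval_X, Polynomial.aeval_C] at hsplit
    have : Polynomial.aeval x h
        = -(Polynomial.aeval P.uniformizer H.divX * P.uniformizer) := by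
      rw [hh]
      exact eq_neg_of_add_eq_zero_right hsplit
    rw [this, AddValuation.map_neg]
    exact P.v_mul_pos hdiv hs

end Basic
end Place

/-! ### Power series expansions in a local parameter -/

namespace Place

section Expansion

open PowerSeries

variable {k K : Type*} [Field k] [Field K] [Algebra k K] (P : Place k K)

theorem v_uniformizer_pow_mul (n : ℕ) (x : K) : P.v (P.uniformizer ^ n * x) = n + P.v x := by
  rw [AddValuation.map_mul, AddValuation.map_pow, P.v_uniformizer, nsmul_one]

theorem exists_eq_uniformizer_pow_mul {n : ℕ} {x : K} (hx : (n : WithTop ℤ) ≤ P.v x) :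
    ∃ y, 0 ≤ P.v y ∧ x = P.uniformizer ^ n * y := by
  have hs := pow_ne_zero n P.uniformizer_ne_zero
  refine ⟨x / P.uniformizer ^ n, ?_, (mul_div_cancel₀ x hs).symm⟩
  by_cases h0 : x = 0
  · simp [h0]
  have h := P.v_uniformizer_pow_mul n (x / P.uniformizer ^ n)
  rw [mul_div_cancel₀ x hs, P.v_eq_ord (div_ne_zero h0 hs)] at h
  rw [P.v_eq_ord (div_ne_zero h0 hs)]
  rw [h] at hx
  norm_cast at hx ⊢
  have hx' : (n : ℤ) ≤ n + P.ord (x / P.uniformizer ^ n) := by exact_mod_cast hx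
  omega

theorem one_le_of_pos {x : K} (hx : 0 < P.v x) : ((1 : ℕ) : WithTop ℤ) ≤ P.v x := by
  by_cases h0 : x = 0
  · simp [h0]
  rw [P.v_eq_ord h0] at hx ⊢
  have hx' : 0 < P.ord x := by exact_mod_cast hx
  exact_mod_cast hx'

theorem le_v_uniformizer_pow_mul_iff {m n : ℕ} {x : K} :
    ((n + m : ℕ) : WithTop ℤ) ≤ P.v (P.uniformizer ^ n * x) ↔ (m : WithTop ℤ) ≤ P.v x := by
  rw [P.v_uniformizer_pow_mul, Nat.cast_add]
  by_cases h0 : x = 0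
  · simp [h0]
  rw [P.v_eq_ord h0]
  norm_cast
  constructor
  · intro h
    have h' : (n : ℤ) + m ≤ n + P.ord x := by exact_mod_cast h
    have : (m : ℤ) ≤ P.ord x := by omega
    exact_mod_cast this
  · intro h
    have h' : (m : ℤ) ≤ P.ord x := by exact_mod_cast h
    have : (n : ℤ) + m ≤ n + P.ord x := by omega
    exact_mod_cast this

theorem zero_le_v_aeval {x : K} (hx : 0 ≤ P.v x) (p : Polynomial k) :
    0 ≤ P.v (Polynomial.aeval x p) := by
  rw [Polynomial.aeval_eq_sum_range]
  refine AddValuation.map_le_sum P.v fun i _ => ?_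
  rw [Algebra.smul_def]
  exact P.zero_le_v_mul (P.zero_le_v_algebraMap _) (P.zero_le_v_pow hx _)

theorem v_uniformizer_pos : 0 < P.v P.uniformizer := by rw [P.v_uniformizer]; decide

theorem le_v_aeval_uniformizer_iff (p : Polynomial k) (n : ℕ) :
    (n : WithTop ℤ) ≤ P.v (Polynomial.aeval P.uniformizer p) ↔ Polynomial.X ^ n ∣ p := by
  constructor
  · induction n with
    | zero => simp
    | succ n ih =>
      intro h
      obtain ⟨r, rfl⟩ := ih (le_trans (by exact_mod_cast Nat.le_succ n) h)
      rw [map_mul, map_pow, Polynomial.aeval_X, P.le_v_uniformizer_pow_mul_iff] at h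
      have hr := congrArg (Polynomial.aeval P.uniformizer) r.divX_mul_X_add
      rw [map_add, map_mul, Polynomial.aeval_X, Polynomial.aeval_C] at hr
      have hpos : 0 < P.v (algebraMap k K (r.coeff 0)) := by
        rw [← sub_eq_iff_eq_add'.2 hr.symm, sub_eq_add_neg]
        refine AddValuation.map_lt_add P.v (lt_of_lt_of_le (by exact_mod_cast zero_lt_one) h) ?_
        rw [AddValuation.map_neg]
        exact (P.v_mul_pos (P.zero_le_v_aeval P.v_uniformizer_pos.le _) P.v_uniformizer_pos)
      rw [pow_succ]
      exact mul_dvd_mul_left _ (Polynomial.X_dvd_iff.2 (P.eq_zero_of_v_algebraMap_pos hpos))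
  · rintro ⟨r, rfl⟩
    rw [map_mul, map_pow, Polynomial.aeval_X, P.v_uniformizer_pow_mul]
    exact le_add_of_nonneg_right (P.zero_le_v_aeval P.v_uniformizer_pos.le _)

/-- `G` is the power series expansion of `x` in the chosen local parameter at `P`. -/
def IsExpansion (x : K) (G : k⟦X⟧) : Prop :=
  ∀ N : ℕ, ∃ p : Polynomial k, (X : k⟦X⟧) ^ N ∣ G - p ∧
    (N : WithTop ℤ) ≤ P.v (x - Polynomial.aeval P.uniformizer p)

variable {P}

theorem coe_X_pow_dvd_iff {p : Polynomial k} {n : ℕ} :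
    (X : k⟦X⟧) ^ n ∣ p ↔ Polynomial.X ^ n ∣ p := by
  rw [PowerSeries.X_pow_dvd_iff, Polynomial.X_pow_dvd_iff]
  simp

theorem IsExpansion.X_pow_dvd_iff {x : K} {G : k⟦X⟧} (h : P.IsExpansion x G) (n : ℕ) :
    X ^ n ∣ G ↔ (n : WithTop ℤ) ≤ P.v x := by
  obtain ⟨p, hG, hx⟩ := h n
  have h1 : X ^ n ∣ G ↔ (X : k⟦X⟧) ^ n ∣ p := (dvd_iff_dvd_of_dvd_sub hG)
  rw [h1, coe_X_pow_dvd_iff, ← P.le_v_aeval_uniformizer_iff]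
  constructor
  · intro h
    simpa using AddValuation.map_le_add P.v hx h
  · intro h
    simpa using AddValuation.map_le_sub P.v h hx

theorem IsExpansion.polynomial (p : Polynomial k) :
    P.IsExpansion (Polynomial.aeval P.uniformizer p) p :=
  fun N => ⟨p, by simp, by simp⟩

theorem IsExpansion.add {x y : K} {G H : k⟦X⟧} (hx : P.IsExpansion x G)
    (hy : P.IsExpansion y H) : P.IsExpansion (x + y) (G + H) := by
  intro N
  obtain ⟨p, hp, hpx⟩ := hx N
  obtain ⟨r, hr, hry⟩ := hy N
  refine ⟨p + r, ?_, ?_⟩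
  · rw [Polynomial.coe_add, add_sub_add_comm]
    exact dvd_add hp hr
  · rw [map_add, add_sub_add_comm]
    exact AddValuation.map_le_add P.v hpx hry

theorem IsExpansion.neg {x : K} {G : k⟦X⟧} (hx : P.IsExpansion x G) :
    P.IsExpansion (-x) (-G) := by
  intro N
  obtain ⟨p, hp, hpx⟩ := hx N
  refine ⟨-p, ?_, ?_⟩
  · rw [Polynomial.coe_neg, ← neg_sub']
    exact (dvd_neg).2 hp
  · rw [map_neg, ← neg_sub', AddValuation.map_neg]
    exact hpx

theorem IsExpansion.zero_le {x : K} {G : k⟦X⟧} (hx : P.IsExpansion x G) : 0 ≤ P.v x := by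
  simpa using (hx.X_pow_dvd_iff 0).1 (by simp)

theorem IsExpansion.mul {x y : K} {G H : k⟦X⟧} (hx : P.IsExpansion x G)
    (hy : P.IsExpansion y H) : P.IsExpansion (x * y) (G * H) := by
  intro N
  obtain ⟨p, hp, hpx⟩ := hx N
  obtain ⟨r, hr, hry⟩ := hy N
  refine ⟨p * r, ?_, ?_⟩
  · rw [Polynomial.coe_mul, show G * H - (p : k⟦X⟧) * r = (G - p) * H + p * (H - r) by ring]
    exact dvd_add (hp.mul_right _) (hr.mul_left _)
  · rw [map_mul, show x * y - Polynomial.aeval P.uniformizer p * Polynomial.aeval P.uniformizer r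
      = (x - Polynomial.aeval P.uniformizer p) * y + Polynomial.aeval P.uniformizer p *
        (y - Polynomial.aeval P.uniformizer r) by ring]
    refine AddValuation.map_le_add P.v ?_ ?_
    · simpa using P.le_v_mul hpx hy.zero_le
    · simpa using P.le_v_mul (P.zero_le_v_aeval P.v_uniformizer_pos.le p) hry

theorem IsExpansion.unique {x : K} {G H : k⟦X⟧} (hG : P.IsExpansion x G)
    (hH : P.IsExpansion x H) : G = H := by
  have h := hG.add hH.neg
  rw [← sub_eq_zero]
  ext n
  have := (h.X_pow_dvd_iff (n + 1)).2 (by simp)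
  rw [PowerSeries.X_pow_dvd_iff] at this
  simpa [sub_eq_add_neg] using this n (Nat.lt_succ_self n)

/-- Subtract the residue, divide by the uniformizer, and repeat: `y n` is the n-th remainder and its
residue is the n-th coefficient. -/
theorem exists_isExpansion (hres : ∀ x, 0 ≤ P.v x → ∃ c : k, 0 < P.v (x - algebraMap k K c))
    {x : K} (hx : 0 ≤ P.v x) : ∃ G : k⟦X⟧, P.IsExpansion x G := by
  have step : ∀ z : {z : K // 0 ≤ P.v z}, ∃ cy : k × {z : K // 0 ≤ P.v z},
      (z : K) = algebraMap k K cy.1 + P.uniformizer * cy.2 := by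
    intro z
    obtain ⟨c, hc⟩ := hres z z.2
    obtain ⟨y, hy, h⟩ := P.exists_eq_uniformizer_pow_mul (P.one_le_of_pos hc)
    refine ⟨(c, ⟨y, hy⟩), ?_⟩
    simpa [sub_eq_iff_eq_add'] using h
  choose cy hcy using step
  let y : ℕ → {z : K // 0 ≤ P.v z} := fun n => Nat.rec ⟨x, hx⟩ (fun _ z => (cy z).2) n
  let G : k⟦X⟧ := PowerSeries.mk fun n => (cy (y n)).1
  have key : ∀ N, x = Polynomial.aeval P.uniformizer (trunc N G) + P.uniformizer ^ N * (y N).1 := by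
    intro N
    induction N with
    | zero => simp [y]
    | succ N ih =>
      rw [trunc_succ, map_add, Polynomial.aeval_monomial]
      conv_lhs => rw [ih, hcy (y N)]
      simp only [G, coeff_mk, y]
      ring
  refine ⟨G, fun N => ⟨trunc N G, ?_, ?_⟩⟩
  · rw [PowerSeries.X_pow_dvd_iff]
    intro m hm
    simp [coeff_trunc, hm]
  · conv_rhs => rw [key N]
    rw [add_sub_cancel_left, P.v_uniformizer_pow_mul]
    exact le_add_of_nonneg_right (y N).2

/-- The expansion of the functions regular at `P` in the chosen local parameter. -/
def expand (hres : ∀ x, 0 ≤ P.v x → ∃ c : k, 0 < P.v (x - algebraMap k K c)) :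
    P.valRing →+* k⟦X⟧ where
  toFun x := (exists_isExpansion hres x.2).choose
  map_one' := (exists_isExpansion hres (1 : P.valRing).2).choose_spec.unique
    (by simpa using IsExpansion.polynomial (P := P) 1)
  map_zero' := (exists_isExpansion hres (0 : P.valRing).2).choose_spec.unique
    (by simpa using IsExpansion.polynomial (P := P) 0)
  map_mul' x y := (exists_isExpansion hres (x * y).2).choose_spec.unique
    ((exists_isExpansion hres x.2).choose_spec.mul (exists_isExpansion hres y.2).choose_spec)
  map_add' x y := (exists_isExpansion hres (x + y).2).choose_spec.unique
    ((exists_isExpansion hres x.2).choose_spec.add (exists_isExpansion hres y.2).choose_spec)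

variable (hres : ∀ x, 0 ≤ P.v x → ∃ c : k, 0 < P.v (x - algebraMap k K c))

theorem isExpansion_expand (x : P.valRing) : P.IsExpansion (x : K) (expand hres x) :=
  (exists_isExpansion hres x.2).choose_spec

theorem X_pow_dvd_expand_iff (x : P.valRing) (n : ℕ) :
    X ^ n ∣ expand hres x ↔ (n : WithTop ℤ) ≤ P.v (x : K) :=
  (isExpansion_expand hres x).X_pow_dvd_iff n

theorem expand_injective : Function.Injective (expand hres) := by
  rw [injective_iff_map_eq_zero]
  intro x hx
  by_contra h0
  have h0' : (x : K) ≠ 0 := fun h => h0 (Subtype.ext h)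
  have h1 := (X_pow_dvd_expand_iff hres x ((P.ord x).toNat + 1)).1 (by rw [hx]; exact dvd_zero _)
  rw [P.v_eq_ord h0'] at h1
  have h2 : (((P.ord x).toNat + 1 : ℕ) : ℤ) ≤ P.ord x := by exact_mod_cast h1
  omega

theorem expand_algebraMap (c : k) (hc : algebraMap k K c ∈ P.valRing) :
    expand hres ⟨algebraMap k K c, hc⟩ = C c :=
  (isExpansion_expand hres _).unique
    (by simpa using IsExpansion.polynomial (P := P) (Polynomial.C c))

theorem expand_uniformizer (hs : P.uniformizer ∈ P.valRing) :
    expand hres ⟨P.uniformizer, hs⟩ = X :=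
  (isExpansion_expand hres _).unique
    (by simpa using IsExpansion.polynomial (P := P) Polynomial.X)

end Expansion

end Place

/-! ### Hasse derivatives of formal power series -/

section HasseSeries

open PowerSeries

variable {R : Type*} [CommRing R]

/-- The Hasse derivatives of a formal power series. -/
def hasseSeries (i : ℕ) (G : R⟦X⟧) : R⟦X⟧ :=
  PowerSeries.mk fun n => ((n + i).choose i : R) * coeff (n + i) G

theorem coeff_hasseSeries (i n : ℕ) (G : R⟦X⟧) :
    coeff n (hasseSeries i G) = ((n + i).choose i : R) * coeff (n + i) G := coeff_mk _ _

-- A coefficient of a Hasse derivative depends only on a truncation, so the Leibniz rule can be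
-- imported from polynomials.
theorem coeff_hasseSeries_eq_coeff_hasseDeriv_trunc {i n N : ℕ} (G : R⟦X⟧) (h : n + i < N) :
    coeff n (hasseSeries i G) = (Polynomial.hasseDeriv i (trunc N G)).coeff n := by
  rw [coeff_hasseSeries, Polynomial.hasseDeriv_coeff, coeff_trunc, if_pos h]

theorem hasseSeries_mul (i : ℕ) (G H : R⟦X⟧) :
    hasseSeries i (G * H)
      = ∑ ab ∈ Finset.HasAntidiagonal.antidiagonal i, hasseSeries ab.1 G * hasseSeries ab.2 H := by
  ext n
  have h1 : coeff n (hasseSeries i (G * H)) =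
      (Polynomial.hasseDeriv i (trunc (n + i + 1) G * trunc (n + i + 1) H)).coeff n := by
    rw [coeff_hasseSeries, Polynomial.hasseDeriv_coeff, coeff_mul, Polynomial.coeff_mul]
    congr 1
    refine Finset.sum_congr rfl fun ab hab => ?_
    have := Finset.HasAntidiagonal.mem_antidiagonal.1 hab
    rw [coeff_trunc, coeff_trunc, if_pos (by omega), if_pos (by omega)]
  rw [h1, Polynomial.hasseDeriv_mul, Polynomial.finsetSum_coeff, map_sum]
  refine Finset.sum_congr rfl fun ab hab => ?_
  have := Finset.HasAntidiagonal.mem_antidiagonal.1 hab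
  rw [coeff_mul, Polynomial.coeff_mul]
  refine Finset.sum_congr rfl fun cd hcd => ?_
  have := Finset.HasAntidiagonal.mem_antidiagonal.1 hcd
  rw [← coeff_hasseSeries_eq_coeff_hasseDeriv_trunc G (by omega),
    ← coeff_hasseSeries_eq_coeff_hasseDeriv_trunc H (by omega)]

theorem hasseSeries_zero (G : R⟦X⟧) : hasseSeries 0 G = G := by
  ext n
  simp [coeff_hasseSeries]

theorem hasseSeries_C {i : ℕ} (hi : i ≠ 0) (c : R) : hasseSeries i (C c) = 0 := by
  ext n
  simp [coeff_hasseSeries, coeff_C, hi]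

theorem hasseSeries_one_X : hasseSeries 1 (X : R⟦X⟧) = 1 := by
  ext n
  rcases n with _ | n <;> simp [coeff_hasseSeries, coeff_X, coeff_one]

theorem hasseSeries_add (i : ℕ) (G H : R⟦X⟧) :
    hasseSeries i (G + H) = hasseSeries i G + hasseSeries i H := by
  ext n
  simp [coeff_hasseSeries, mul_add]

theorem hasseSeries_smul (i : ℕ) (c : R) (G : R⟦X⟧) :
    hasseSeries i (c • G) = c • hasseSeries i G := by
  ext n
  simp [coeff_hasseSeries, mul_left_comm]

/-- The Taylor expansion of a formal power series. -/
def taylorSeries : R⟦X⟧ →+* R⟦X⟧⟦X⟧ where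
  toFun G := PowerSeries.mk fun i => hasseSeries i G
  map_one' := by
    ext i : 1
    rw [coeff_mk, coeff_one]
    split_ifs with h
    · rw [h, hasseSeries_zero]
    · simpa using hasseSeries_C h (1 : R)
  map_zero' := by
    ext i : 1
    rw [coeff_mk, map_zero]
    ext n
    simp [coeff_hasseSeries]
  map_mul' G H := by
    ext i : 1
    simp only [coeff_mk, coeff_mul, hasseSeries_mul]
  map_add' G H := by
    ext i : 1
    simp only [coeff_mk, map_add, hasseSeries_add]

theorem coeff_taylorSeries (i : ℕ) (G : R⟦X⟧) : coeff i (taylorSeries G) = hasseSeries i G := by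
  simp only [taylorSeries, RingHom.coe_mk, MonoidHom.coe_mk, OneHom.coe_mk, coeff_mk]

theorem taylorSeries_C (c : R) : taylorSeries (C c) = C (C c) := by
  ext i : 1
  rw [coeff_taylorSeries, coeff_C]
  split_ifs with h
  · rw [h, hasseSeries_zero]
  · exact hasseSeries_C h c

end HasseSeries

/-! ### Alternating maps under triangular transformations -/

section Alternating

/-- Pigeonhole: if the sorted sequence exceeds `κ s` at s, the sorting permutation sends all indices
≥ s to indices > s, because κ dominates ρ there. -/
theorem _root_.StrictMono.comp_sort_le {r : ℕ} {κ ρ : Fin r → ℕ} (hκ : StrictMono κ)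
    (hle : ∀ s, ρ s ≤ κ s) (s : Fin r) : ρ (Tuple.sort ρ s) ≤ κ s := by
  by_contra! hlt
  have hmaps : ∀ x ∈ Finset.Ici s, Tuple.sort ρ x ∈ Finset.Ioi s := by
    intro x hx
    rw [Finset.mem_Ioi, ← hκ.lt_iff_lt]
    exact (hlt.trans_le (Tuple.monotone_sort ρ (Finset.mem_Ici.1 hx))).trans_le (hle _)
  have hcard := Finset.card_le_card_of_injOn _ hmaps (Tuple.sort ρ).injective.injOn
  rw [Fin.card_Ici, Fin.card_Ioi] at hcard
  omega

/-- An alternating map applied to a triangular transform of a sequence of vectors, at a family of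
indices which is minimal for nonvanishing. -/
theorem _root_.AlternatingMap.map_triangular {R V W : Type*} [CommRing R] [AddCommGroup V]
    [Module R V] [AddCommGroup W] [Module R W] {r : ℕ} (G : V [⋀^Fin r]→ₗ[R] W) (x y : ℕ → V)
    (c : ℕ → ℕ → R) (hy : ∀ l, y l = ∑ i ∈ Finset.range (l + 1), c l i • x i) (κ : Fin r → ℕ)
    (hκ : StrictMono κ)
    (hmin : ∀ ρ : Fin r → ℕ, StrictMono ρ → (∀ s, ρ s ≤ κ s) → ρ ≠ κ → G (fun s => x (ρ s)) = 0) :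
    G (fun s => y (κ s)) = (∏ s, c (κ s) (κ s)) • G (fun s => x (κ s)) := by
  simp only [hy]
  have hexp := G.toMultilinearMap.map_sum_finset (fun s i => c (κ s) i • x i)
    (fun s => Finset.range (κ s + 1))
  refine hexp.trans ?_
  rw [Finset.sum_eq_single κ]
  · exact G.map_smul_univ (fun s => c (κ s) (κ s)) (fun s => x (κ s))
  · intro ρ hρ hne
    have hle : ∀ s, ρ s ≤ κ s := fun s =>
      Nat.lt_succ_iff.1 (Finset.mem_range.1 (Fintype.mem_piFinset.1 hρ s))
    refine (G.map_smul_univ (fun s => c (κ s) (ρ s)) (fun s => x (ρ s))).trans ?_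
    suffices h : G (fun s => x (ρ s)) = 0 by rw [h, smul_zero]
    -- Repeated indices vanish by alternation. Otherwise sorting ρ gives an increasing sequence
    -- still dominated by κ, to which minimality applies unless it is κ itself; in that case ρ and κ
    -- have equal sums, and ρ ≤ κ forces ρ = κ.
    by_cases hinj : Function.Injective ρ
    · have hz := hmin (ρ ∘ Tuple.sort ρ)
        ((Tuple.monotone_sort ρ).strictMono_of_injective (hinj.comp (Tuple.sort ρ).injective))
        (hκ.comp_sort_le hle) (fun h => hne ?_)
      · have := G.map_perm (fun s => x (ρ s)) (Tuple.sort ρ)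
        have h0 : G ((fun s => x (ρ s)) ∘ Tuple.sort ρ) = 0 := hz
        rw [h0] at this
        exact (smul_eq_zero_iff_eq _).1 this.symm
      · have hsum : ∑ s, ρ s = ∑ s, κ s := by
          rw [← h]
          exact (Equiv.sum_comp (Tuple.sort ρ) ρ).symm
        exact funext fun s =>
          (Finset.sum_eq_sum_iff_of_le fun i _ => hle i).1 hsum s (Finset.mem_univ s)
    · refine G.map_eq_zero_of_not_injective _ fun h => hinj ?_
      exact fun a b hab => h (congrArg x hab)
  · intro h
    exact absurd (Fintype.mem_piFinset.2 fun s => Finset.mem_range.2 (Nat.lt_succ_self _)) h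

end Alternating

/-! ### Rigidity of the function field over a separating variable -/

section Rigidity

theorem pushout_induction (F k L : Type*) {K : Type*} [Field F] [Field k] [Field L] [Field K]
    [Algebra F k] [Algebra F L] [Algebra F K] [Algebra k K] [Algebra L K]
    [IsScalarTower F k K] [IsScalarTower F L K] [Algebra.IsPushout F k L K]
    {motive : K → Prop} (x : K) (hL : ∀ l : L, motive (algebraMap L K l))
    (hmul : ∀ (c : k) (x : K), motive x → motive (algebraMap k K c * x))
    (hadd : ∀ x y : K, motive x → motive y → motive (x + y)) : motive x := by
  obtain ⟨y, rfl⟩ := (Algebra.IsPushout.equiv F k L K).surjective x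
  induction y using TensorProduct.induction_on with
  | zero => simpa using hL 0
  | tmul c l =>
    rw [Algebra.IsPushout.equiv_tmul]
    exact hmul c _ (hL l)
  | add x y hx hy =>
    rw [map_add]
    exact hadd _ _ hx hy

variable {F k L K : Type*} [Field F] [Field k] [Field L] [Field K]
    [Algebra F k] [Algebra F L] [Algebra F K] [Algebra k K] [Algebra L K]
    [IsScalarTower F k K] [IsScalarTower F L K] [Algebra.IsPushout F k L K]

/-- Ring homomorphisms out of the function field which are congruent modulo an ideal contained in
the Jacobson radical are equal once they agree on the constants and on a separating variable. -/
theorem ringHom_eq_of_isSeparatingVariable {t : L} (ht : IsSeparatingVariable F t) {B : Type*}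
    [CommRing B] (ψ₁ ψ₂ : K →+* B) (I : Ideal B) (hI : ∀ x ∈ I, IsUnit (1 + x))
    (hk : ∀ c : k, ψ₁ (algebraMap k K c) = ψ₂ (algebraMap k K c))
    (htt : ψ₁ (algebraMap L K t) = ψ₂ (algebraMap L K t))
    (hmod : ∀ x, ψ₂ x - ψ₁ x ∈ I) : ψ₁ = ψ₂ := by
  let S : IntermediateField F L :=
    { carrier := {l | ψ₁ (algebraMap L K l) = ψ₂ (algebraMap L K l)}
      mul_mem' := fun {a b} ha hb => by
        simp only [Set.mem_ofPred_eq, map_mul] at *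
        rw [ha, hb]
      add_mem' := fun {a b} ha hb => by
        simp only [Set.mem_ofPred_eq, map_add] at *
        rw [ha, hb]
      algebraMap_mem' := fun a => by
        simp only [Set.mem_ofPred_eq]
        rw [← IsScalarTower.algebraMap_apply, IsScalarTower.algebraMap_apply F k K]
        exact hk _
      inv_mem' := fun a ha => by
        simp only [Set.mem_ofPred_eq] at *
        by_cases h0 : a = 0
        · simp [h0]
        have h0' : algebraMap L K a ≠ 0 := by simpa using h0
        have e₁ : ψ₁ (algebraMap L K a) * ψ₁ (algebraMap L K a⁻¹) = 1 := by
          rw [← map_mul, map_inv₀, mul_inv_cancel₀ h0', map_one]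
        have e₂ : ψ₂ (algebraMap L K a) * ψ₂ (algebraMap L K a⁻¹) = 1 := by
          rw [← map_mul, map_inv₀, mul_inv_cancel₀ h0', map_one]
        rw [ha] at e₁
        exact left_inv_eq_right_inv ((mul_comm _ _).trans e₁) e₂ }
  have hS : IntermediateField.adjoin F {t} ≤ S := by
    rw [IntermediateField.adjoin_le_iff, Set.singleton_subset_iff]
    exact htt
  have hL : ∀ l : L, ψ₁ (algebraMap L K l) = ψ₂ (algebraMap L K l) := by
    intro l
    set E := IntermediateField.adjoin F {t}
    have : Algebra.IsSeparable E L := ht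
    have hsep : (minpoly E l).Separable := Algebra.IsSeparable.isSeparable E l
    set p := minpoly E l
    have ev : ∀ (ψ : K →+* B) (g : Polynomial E),
        g.eval₂ ((ψ.comp (algebraMap L K)).comp (algebraMap E L)) (ψ (algebraMap L K l))
          = ψ (algebraMap L K (Polynomial.aeval l g)) := by
      intro ψ g
      exact (Polynomial.hom_eval₂ g (algebraMap E L) (ψ.comp (algebraMap L K)) l).symm
    have hcomp : (ψ₁.comp (algebraMap L K)).comp (algebraMap E L)
        = (ψ₂.comp (algebraMap L K)).comp (algebraMap E L) := by
      ext a
      exact hS a.2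
    have h₁ := ev ψ₁ p
    have h₁' := ev ψ₁ p.derivative
    have h₂ := ev ψ₂ p
    rw [← hcomp] at h₂
    rw [minpoly.aeval, map_zero, map_zero, ← Polynomial.eval_map] at h₁ h₂
    rw [← Polynomial.eval_map, ← Polynomial.derivative_map] at h₁'
    have hne : algebraMap L K (Polynomial.aeval l p.derivative) ≠ 0 := by
      rw [Ne, map_eq_zero]
      exact hsep.aeval_derivative_ne_zero (minpoly.aeval E l)
    obtain ⟨u, hu⟩ := (IsUnit.mk0 _ hne).map ψ₁
    -- Uniqueness as in Hensel's lemma: both images of l are roots of the same polynomial and differ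
    -- by e in I. Expanding to second order gives u·e + z·e² = 0 with u a unit by separability, and
    -- 1 + u⁻¹·z·e is a unit, so e = 0.
    obtain ⟨z, hz⟩ := Polynomial.binomExpansion
      (p.map ((ψ₁.comp (algebraMap L K)).comp (algebraMap E L))) (ψ₁ (algebraMap L K l))
      (ψ₂ (algebraMap L K l) - ψ₁ (algebraMap L K l))
    set e := ψ₂ (algebraMap L K l) - ψ₁ (algebraMap L K l) with he
    have hadd : ψ₁ (algebraMap L K l) + e = ψ₂ (algebraMap L K l) := by rw [he]; ring
    rw [hadd, h₁, h₁', h₂, ← hu] at hz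
    have hunit := hI (↑u⁻¹ * z * e) (I.mul_mem_left _ (hmod _))
    have hzero : (1 + ↑u⁻¹ * z * e) * e = 0 := by
      have : (↑u⁻¹ : B) * (0 + u * e + z * e ^ 2) = 0 := by rw [← hz, mul_zero]
      calc (1 + ↑u⁻¹ * z * e) * e = (↑u⁻¹ * ↑u) * e + ↑u⁻¹ * z * e ^ 2 := by
            rw [Units.inv_mul]; ring
        _ = 0 := by rw [← this]; ring
    rw [hunit.mul_right_eq_zero] at hzero
    exact (sub_eq_zero.1 hzero).symm
  ext x
  refine pushout_induction F k L (motive := fun x => ψ₁ x = ψ₂ x) x hL ?_ ?_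
  · intro c x hx
    rw [map_mul, map_mul, hx, hk]
  · intro x y hx hy
    rw [map_add, map_add, hx, hy]

/-- A derivation of the function field, trivial on the constants and on a separating variable,
vanishes. -/
theorem derivation_eq_zero_of_isSeparatingVariable {t : L} (ht : IsSeparatingVariable F t)
    {M : Type*} [AddCommGroup M] [Module k M] [Module K M]
    (d : Derivation k K M) (hdt : d (algebraMap L K t) = 0) : d = 0 := by
  let S : IntermediateField F L :=
    { carrier := {l | d (algebraMap L K l) = 0}
      mul_mem' := fun {a b} ha hb => by
        simp only [Set.mem_ofPred_eq, map_mul, Derivation.leibniz] at *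
        rw [ha, hb, smul_zero, smul_zero, add_zero]
      add_mem' := fun {a b} ha hb => by
        simp only [Set.mem_ofPred_eq, map_add] at *
        rw [ha, hb, add_zero]
      algebraMap_mem' := fun a => by
        simp only [Set.mem_ofPred_eq]
        rw [← IsScalarTower.algebraMap_apply, IsScalarTower.algebraMap_apply F k K]
        exact d.map_algebraMap _
      inv_mem' := fun a ha => by
        simp only [Set.mem_ofPred_eq] at *
        rw [map_inv₀, Derivation.leibniz_inv, ha, smul_zero] }
  have hS : IntermediateField.adjoin F {t} ≤ S := by
    rw [IntermediateField.adjoin_le_iff, Set.singleton_subset_iff]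
    exact hdt
  have hL : ∀ l : L, d (algebraMap L K l) = 0 := by
    intro l
    set E := IntermediateField.adjoin F {t}
    have : Algebra.IsSeparable E L := ht
    have hsep : (minpoly E l).Separable := Algebra.IsSeparable.isSeparable E l
    have hchain : ∀ p : Polynomial E, d (algebraMap L K (Polynomial.aeval l p))
        = algebraMap L K (Polynomial.aeval l p.derivative) • d (algebraMap L K l) := by
      intro p
      induction p using Polynomial.induction_on' with
      | add p r hp hr => simp only [map_add, hp, hr, add_smul]
      | monomial n a =>
        have ha : d (algebraMap L K (algebraMap E L a)) = 0 := hS a.2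
        rw [Polynomial.aeval_monomial, map_mul, map_pow, Derivation.leibniz, ha, smul_zero,
          add_zero, Derivation.leibniz_pow, Polynomial.derivative_monomial,
          Polynomial.aeval_monomial, ← Nat.cast_smul_eq_nsmul K, smul_smul, smul_smul]
        congr 1
        simp only [map_mul, map_pow, map_natCast, mul_assoc]
    -- The chain rule applied to the vanishing minimal polynomial; its derivative does not vanish at
    -- l by separability.
    have h := hchain (minpoly E l)
    rw [minpoly.aeval, map_zero, map_zero] at h
    refine (smul_eq_zero.1 h.symm).resolve_left ?_
    rw [map_eq_zero]
    exact hsep.aeval_derivative_ne_zero (minpoly.aeval E l)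
  ext x
  refine pushout_induction F k L (motive := fun x => d x = 0) x hL ?_ ?_
  · intro c x hx
    rw [Derivation.leibniz, hx, d.map_algebraMap, smul_zero, smul_zero, add_zero]
  · intro x y hx hy
    rw [map_add, hx, hy, add_zero]

/-- L is algebraic over F(t) and K is generated by k and L, so K is algebraic over k(t). This
provides the hypothesis of `exists_residue`. -/
theorem trdeg_le_one_of_isSeparatingVariable {t : L} (ht : IsSeparatingVariable F t) :
    Algebra.trdeg k K ≤ 1 := by
  let E := IntermediateField.adjoin k {algebraMap L K t}
  have hE : IntermediateField.adjoin F {t}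
      ≤ (E.restrictScalars F).comap (IsScalarTower.toAlgHom F L K) := by
    rw [IntermediateField.adjoin_le_iff, Set.singleton_subset_iff]
    exact IntermediateField.subset_adjoin k _ (Set.mem_singleton _)
  have : Algebra.IsSeparable (IntermediateField.adjoin F {t}) L := ht
  let φ : IntermediateField.adjoin F {t} →+* E :=
    ((algebraMap L K).comp (algebraMap (IntermediateField.adjoin F {t}) L)).codRestrict
      E.toSubring fun a => hE a.2
  have hint : ∀ x : K, IsIntegral E x := by
    intro x
    refine pushout_induction F k L x ?_ ?_ ?_
    · intro l
      exact (Algebra.IsSeparable.isIntegral (IntermediateField.adjoin F {t}) l).map_of_comp_eq φ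
        (algebraMap L K) rfl
    · intro c x hx
      refine IsIntegral.mul ?_ hx
      exact isIntegral_algebraMap (x := algebraMap k E c)
    · intro x y hx hy
      exact hx.add hy
  have halg : Algebra.IsAlgebraic (Algebra.adjoin k {algebraMap L K t}) K := by
    have : Algebra.IsAlgebraic E K := ⟨fun x => (hint x).isAlgebraic⟩
    exact IntermediateField.isAlgebraic_adjoin_iff_top.1 this
  simpa using Algebra.IsAlgebraic.trdeg_le_cardinalMk k {algebraMap L K t}

end Rigidity

/-! ### The generating series of the Hasse derivatives -/

section HasseSystem

open PowerSeries

variable {k K : Type*} [Field k] [Field K] [Algebra k K] {t : K} {D : ℕ → K →ₗ[k] K}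

/-- The generating series of a system of Hasse derivatives. -/
def IsHasseSystem.taylor (hD : IsHasseSystem t D) : K →+* K⟦X⟧ :=
  have hmul : ∀ x y, PowerSeries.mk (fun i => D i (x * y))
      = PowerSeries.mk (fun i => D i x) * PowerSeries.mk (fun i => D i y) := by
    intro x y
    ext i : 1
    simp only [coeff_mk, coeff_mul, hD.leibniz]
  { toFun := fun x => PowerSeries.mk fun i => D i x
    map_one' := by
      -- The values at 1 are not part of the axioms: the generating series of 1 is idempotent, and
      -- nonzero since `D 0` is the identity.
      have h := hmul 1 1
      rw [mul_one] at h
      refine (mul_right_cancel₀ (b := PowerSeries.mk fun i => D i (1 : K)) ?_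
        (by rw [← h, one_mul])).symm
      intro h0
      have := congrArg (coeff 0) h0
      simp [hD.zero] at this
    map_zero' := by
      ext i : 1
      simp
    map_mul' := hmul
    map_add' := fun x y => by
      ext i : 1
      simp }

theorem IsHasseSystem.coeff_taylor (hD : IsHasseSystem t D) (i : ℕ) (x : K) :
    coeff i (hD.taylor x) = D i x := by
  simp [taylor]

theorem IsHasseSystem.map_one (hD : IsHasseSystem t D) {i : ℕ} (hi : i ≠ 0) : D i 1 = 0 := by
  rw [← hD.coeff_taylor, _root_.map_one, coeff_one, if_neg hi]

theorem IsHasseSystem.taylor_algebraMap (hD : IsHasseSystem t D) (c : k) :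
    hD.taylor (algebraMap k K c) = C (algebraMap k K c) := by
  ext i : 1
  rw [hD.coeff_taylor, coeff_C, Algebra.algebraMap_eq_smul_one, map_smul]
  split_ifs with h
  · simp [h, hD.zero]
  · rw [hD.map_one h, smul_zero]

theorem IsHasseSystem.taylor_var (hD : IsHasseSystem t D) : hD.taylor t = C t + X := by
  ext i : 1
  rw [hD.coeff_taylor, map_add, coeff_C, coeff_X]
  match i with
  | 0 => simp [hD.zero]
  | 1 => simp [hD.one_var]
  | i + 2 => simp [hD.var (i + 2) (by omega)]

/-- The first Hasse derivative as a derivation. -/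
def IsHasseSystem.derivation (hD : IsHasseSystem t D) : Derivation k K K :=
  Derivation.mk' (D 1) fun x y => by
    rw [hD.leibniz, Finset.Nat.sum_antidiagonal_eq_sum_range_succ (fun a b => D a x * D b y)]
    simp [Finset.sum_range_succ, hD.zero, mul_comm]

theorem hasseDeriv_eq_zero_or (k : Type*) {K : Type*} [Field k] [Field K] [Algebra k K] (t : K) :
    IsHasseSystem t (hasseDeriv k t) ∨ ∀ i, hasseDeriv k t i = 0 := by
  by_cases h : ∃ D : ℕ → K →ₗ[k] K, IsHasseSystem t D
  · left
    have : hasseDeriv k t = h.choose := funext fun i => by rw [hasseDeriv, dif_pos h]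
    rw [this]
    exact h.choose_spec
  · right
    intro i
    rw [hasseDeriv, dif_neg h]

/-- `hasseDeriv` defaults to 0 when no Hasse system exists, and then a derivative row of the
determinant would be zero. Nonvanishing therefore yields existence, with no separate construction.
-/
theorem isHasseSystem_of_frobeniusDet_ne_zero {q u m r : ℕ} (hr : 1 ≤ r) {f : Fin (r + 2) → K}
    {ρ : Fin r → ℕ} (h : frobeniusDet k q u m t f ρ ≠ 0) : IsHasseSystem t (hasseDeriv k t) := by
  refine (hasseDeriv_eq_zero_or k t).resolve_right fun h0 => h ?_
  refine Matrix.det_eq_zero_of_row_eq_zero (Fin.succ (Fin.succ ⟨0, hr⟩)) fun i => ?_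
  simp [h0]

end HasseSystem

/-! ### Change of variable from t to the local parameter -/

namespace Place

section Local

open PowerSeries

variable {k K : Type*} [Field k] [Field K] [Algebra k K] {P : Place k K}
  (hres : ∀ x, 0 ≤ P.v x → ∃ c : k, 0 < P.v (x - algebraMap k K c))

/-- The embedding of the function field in the field of formal Laurent series in the local
parameter. -/
def toLaurent : K →+* FractionRing k⟦X⟧ :=
  IsFractionRing.lift (A := P.valRing)
    (g := (algebraMap k⟦X⟧ (FractionRing k⟦X⟧)).comp (expand hres))
    ((IsFractionRing.injective k⟦X⟧ (FractionRing k⟦X⟧)).comp (expand_injective hres))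

theorem toLaurent_coe (x : P.valRing) :
    toLaurent hres x = algebraMap k⟦X⟧ (FractionRing k⟦X⟧) (expand hres x) :=
  IsFractionRing.lift_algebraMap _ x

theorem taylor_expand_isUnit (y : nonZeroDivisors P.valRing) :
    IsUnit (((PowerSeries.map (algebraMap k⟦X⟧ (FractionRing k⟦X⟧))).comp
      (taylorSeries.comp (expand hres))) y) := by
  rw [PowerSeries.isUnit_iff_constantCoeff, isUnit_iff_ne_zero, RingHom.comp_apply,
    RingHom.comp_apply, ← coeff_zero_eq_constantCoeff_apply, coeff_map, coeff_taylorSeries,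
    hasseSeries_zero]
  intro h
  rw [← toLaurent_coe, _root_.map_eq_zero] at h
  exact nonZeroDivisors.ne_zero y.2 (Subtype.ext h)

/-- The Taylor expansion of functions in the local parameter. -/
def localTaylor : K →+* (FractionRing k⟦X⟧)⟦X⟧ :=
  IsLocalization.lift (M := nonZeroDivisors P.valRing) (taylor_expand_isUnit hres)

theorem localTaylor_coe (x : P.valRing) :
    localTaylor hres x = PowerSeries.map (algebraMap k⟦X⟧ (FractionRing k⟦X⟧))
      (taylorSeries (expand hres x)) :=
  IsLocalization.lift_eq (taylor_expand_isUnit hres) x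

theorem coeff_localTaylor_coe (x : P.valRing) (i : ℕ) :
    coeff i (localTaylor hres x)
      = algebraMap k⟦X⟧ (FractionRing k⟦X⟧) (hasseSeries i (expand hres x)) := by
  rw [localTaylor_coe, coeff_map, coeff_taylorSeries]

theorem constantCoeff_localTaylor (x : K) :
    constantCoeff (localTaylor hres x) = toLaurent hres x := by
  have : (constantCoeff (R := FractionRing k⟦X⟧)).comp (localTaylor hres) = toLaurent hres := by
    refine IsLocalization.ringHom_ext (nonZeroDivisors P.valRing) ?_
    ext x : 1
    change constantCoeff (localTaylor hres x) = toLaurent hres x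
    rw [← coeff_zero_eq_constantCoeff_apply, coeff_localTaylor_coe, hasseSeries_zero,
      toLaurent_coe]
  exact congrArg (fun φ : K →+* FractionRing k⟦X⟧ => φ x) this

theorem localTaylor_algebraMap (c : k) :
    localTaylor hres (algebraMap k K c) = C (toLaurent hres (algebraMap k K c)) := by
  have hc : algebraMap k K c ∈ P.valRing := P.zero_le_v_algebraMap c
  have h1 := localTaylor_coe hres ⟨_, hc⟩
  have h2 := toLaurent_coe hres ⟨_, hc⟩
  rw [expand_algebraMap] at h1 h2
  rw [h1, h2, taylorSeries_C, map_C]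

theorem coeff_one_localTaylor_uniformizer :
    coeff 1 (localTaylor hres P.uniformizer) = 1 := by
  have hs : P.uniformizer ∈ P.valRing := P.v_uniformizer_pos.le
  have h1 := coeff_localTaylor_coe hres ⟨_, hs⟩ 1
  rw [expand_uniformizer, hasseSeries_one_X, map_one] at h1
  exact h1

/-- A pole of z would make the expansion of z⁻¹ a multiple of X whose product with G is 1. So z is
regular, and G is its expansion. -/
theorem ord_eq_of_toLaurent_eq {z : K} (hz : z ≠ 0) {G : k⟦X⟧}
    (h : toLaurent hres z = algebraMap k⟦X⟧ (FractionRing k⟦X⟧) G) (n : ℕ) :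
    X ^ n ∣ G ↔ (n : ℤ) ≤ P.ord z := by
  have hmem : z ∈ P.valRing := by
    by_contra hmem
    rw [mem_valRing, P.v_eq_ord hz, not_le] at hmem
    have hneg : P.ord z < 0 := by exact_mod_cast hmem
    have hinv : ((1 : ℕ) : WithTop ℤ) ≤ P.v z⁻¹ := by
      rw [P.v_eq_ord (inv_ne_zero hz), P.ord_inv hz]
      have : (1 : ℤ) ≤ -P.ord z := by omega
      exact_mod_cast this
    have hmem' : z⁻¹ ∈ P.valRing := le_trans (by simp) hinv
    have h1 := toLaurent_coe hres ⟨z⁻¹, hmem'⟩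
    obtain ⟨H, hH⟩ := (X_pow_dvd_expand_iff hres ⟨z⁻¹, hmem'⟩ 1).2 hinv
    have h2 : G * expand hres ⟨z⁻¹, hmem'⟩ = 1 := by
      apply IsFractionRing.injective k⟦X⟧ (FractionRing k⟦X⟧)
      rw [map_mul, ← h, ← h1, ← map_mul]
      simp [hz]
    have h3 := congrArg constantCoeff h2
    rw [hH] at h3
    simp at h3
  have h1 := toLaurent_coe hres ⟨z, hmem⟩
  have h2 : G = expand hres ⟨z, hmem⟩ :=
    IsFractionRing.injective k⟦X⟧ (FractionRing k⟦X⟧) (h.symm.trans h1)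
  rw [h2, X_pow_dvd_expand_iff, P.v_eq_ord hz]
  norm_cast

section Compare

variable {F L : Type*} [Field F] [Field L] [Algebra F k] [Algebra F L] [Algebra F K] [Algebra L K]
  [IsScalarTower F k K] [IsScalarTower F L K] [Algebra.IsPushout F k L K]
  {t : L} {D : ℕ → K →ₗ[k] K}

/-- The increment of `x` in its Taylor expansion. -/
def increment (x : K) : (FractionRing k⟦X⟧)⟦X⟧ := localTaylor hres x - C (toLaurent hres x)

theorem constantCoeff_increment (x : K) : constantCoeff (increment hres x) = 0 := by
  rw [increment, map_sub, constantCoeff_localTaylor, constantCoeff_C, sub_self]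

theorem X_pow_dvd_increment_pow (x : K) (i : ℕ) : X ^ i ∣ increment hres x ^ i :=
  pow_dvd_pow_of_dvd (X_dvd_iff.2 (constantCoeff_increment hres x)) i

theorem coeff_subst_increment (x : K) (G : (FractionRing k⟦X⟧)⟦X⟧) (l : ℕ) :
    coeff l (G.subst (increment hres x) : (FractionRing k⟦X⟧)⟦X⟧)
      = ∑ i ∈ Finset.range (l + 1), coeff l (increment hres x ^ i) * coeff i G := by
  rw [coeff_subst' (HasSubst.of_constantCoeff_zero' (constantCoeff_increment hres _)),
    finsum_eq_sum_of_support_subset]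
  · refine Finset.sum_congr rfl fun i _ => ?_
    rw [smul_eq_mul, mul_comm]
  · intro i hi
    rw [Finset.coe_range, Set.mem_Iio]
    by_contra! hlt
    refine hi ?_
    have := X_pow_dvd_iff.1 (X_pow_dvd_increment_pow hres x i) l (by omega)
    simp [this]

/-- The chain rule for Hasse derivatives. Both sides are ring homomorphisms in x that agree on
constants, on t, and modulo X, so rigidity identifies them. -/
theorem localTaylor_eq_subst (ht : IsSeparatingVariable F t)
    (hD : IsHasseSystem (algebraMap L K t) D) (x : K) :
    localTaylor hres x = (PowerSeries.map (toLaurent hres) (hD.taylor x)).subst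
      (increment hres (algebraMap L K t)) := by
  have hsub : HasSubst (increment hres (algebraMap L K t)) :=
    HasSubst.of_constantCoeff_zero' (constantCoeff_increment hres _)
  let ψ : K →+* (FractionRing k⟦X⟧)⟦X⟧ :=
    (substAlgHom (R := FractionRing k⟦X⟧) hsub).toRingHom.comp
      ((PowerSeries.map (toLaurent hres)).comp hD.taylor)
  have hψ : ∀ x, ψ x = (PowerSeries.map (toLaurent hres) (hD.taylor x)).subst
      (increment hres (algebraMap L K t)) := fun x => by
    rw [← coe_substAlgHom hsub]
    rfl
  rw [← hψ]
  suffices h : localTaylor hres = ψ by rw [h]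
  refine ringHom_eq_of_isSeparatingVariable (k := k) ht (localTaylor hres) ψ (Ideal.span {X})
    ?_ ?_ ?_ ?_
  · intro x hx
    rw [Ideal.mem_span_singleton, X_dvd_iff] at hx
    rw [PowerSeries.isUnit_iff_constantCoeff, map_add, hx, map_one, add_zero]
    exact isUnit_one
  · intro c
    rw [hψ, hD.taylor_algebraMap, localTaylor_algebraMap, map_C]
    exact (subst_C _).symm
  · rw [hψ, hD.taylor_var, map_add, map_C, map_X, subst_add hsub, subst_X hsub]
    have : (C (toLaurent hres (algebraMap L K t))).subst (increment hres (algebraMap L K t))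
      = C (toLaurent hres (algebraMap L K t)) := subst_C _
    rw [this, increment]
    ring
  · intro x
    rw [Ideal.mem_span_singleton, X_dvd_iff, map_sub, constantCoeff_localTaylor, hψ,
      ← coeff_zero_eq_constantCoeff_apply, coeff_subst_increment]
    simp [hD.coeff_taylor, hD.zero]

theorem coeff_localTaylor (ht : IsSeparatingVariable F t)
    (hD : IsHasseSystem (algebraMap L K t) D) (x : K) (l : ℕ) :
    coeff l (localTaylor hres x) = ∑ i ∈ Finset.range (l + 1),
      coeff l (increment hres (algebraMap L K t) ^ i) * toLaurent hres (D i x) := by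
  rw [localTaylor_eq_subst hres ht hD, coeff_subst_increment]
  simp only [coeff_map, hD.coeff_taylor]

/-- The relation between the two families of derivatives remains triangular in the presence of a
factor g, with diagonal coefficients g·(dt/ds)^l by `coeff_mul_pow_self`. -/
theorem coeff_localTaylor_mul (ht : IsSeparatingVariable F t)
    (hD : IsHasseSystem (algebraMap L K t) D) (g x : K) (l : ℕ) :
    coeff l (localTaylor hres (g * x)) = ∑ i ∈ Finset.range (l + 1),
      coeff l (localTaylor hres g * increment hres (algebraMap L K t) ^ i)
        * toLaurent hres (D i x) := by
  rw [map_mul, coeff_mul]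
  simp only [coeff_mul, Finset.sum_mul]
  rw [Finset.sum_comm]
  refine Finset.sum_congr rfl fun ab hab => ?_
  have hab := Finset.HasAntidiagonal.mem_antidiagonal.1 hab
  rw [coeff_localTaylor hres ht hD x, Finset.mul_sum]
  simp only [mul_assoc]
  refine Finset.sum_subset (fun i hi => ?_) fun i _ hi => ?_
  · rw [Finset.mem_range] at hi ⊢
    omega
  · rw [Finset.mem_range] at hi
    rw [X_pow_dvd_iff.1 (X_pow_dvd_increment_pow hres (algebraMap L K t) i) ab.2 (by omega)]
    simp

theorem coeff_mul_pow_self {R : Type*} [CommRing R] (G W : R⟦X⟧) (hW : constantCoeff W = 0)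
    (l : ℕ) : coeff l (G * W ^ l) = constantCoeff G * coeff 1 W ^ l := by
  obtain ⟨V, rfl⟩ := X_dvd_iff.2 hW
  rw [mul_pow, mul_left_comm, coeff_X_pow_mul', if_pos le_rfl, Nat.sub_self,
    coeff_zero_eq_constantCoeff_apply, map_mul, map_pow]
  congr 2
  rw [show (1 : ℕ) = 0 + 1 from rfl, coeff_succ_X_mul, coeff_zero_eq_constantCoeff_apply]

/-- This is (dt/ds)·(ds/dt) = 1, read off the first Taylor coefficient of the local parameter s. -/
theorem coeff_one_increment_mul (ht : IsSeparatingVariable F t)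
    (hD : IsHasseSystem (algebraMap L K t) D) :
    coeff 1 (increment hres (algebraMap L K t)) * toLaurent hres (D 1 P.uniformizer) = 1 := by
  have h := coeff_localTaylor hres ht hD P.uniformizer 1
  rw [coeff_one_localTaylor_uniformizer] at h
  rw [h]
  simp [Finset.sum_range_succ, coeff_one]

theorem hasse_one_uniformizer_ne_zero
    (hres : ∀ x, 0 ≤ P.v x → ∃ c : k, 0 < P.v (x - algebraMap k K c))
    (ht : IsSeparatingVariable F t)
    (hD : IsHasseSystem (algebraMap L K t) D) : D 1 P.uniformizer ≠ 0 := by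
  intro h
  have := coeff_one_increment_mul hres ht hD
  rw [h, map_zero, mul_zero] at this
  exact zero_ne_one this

theorem coeff_one_increment (ht : IsSeparatingVariable F t)
    (hD : IsHasseSystem (algebraMap L K t) D) :
    coeff 1 (increment hres (algebraMap L K t)) = toLaurent hres (D 1 P.uniformizer)⁻¹ := by
  rw [map_inv₀]
  exact eq_inv_of_mul_eq_one_left (coeff_one_increment_mul hres ht hD)

theorem kaehler_D_eq (ht : IsSeparatingVariable F t)
    (hD : IsHasseSystem (algebraMap L K t) D) (x : K) : KaehlerDifferential.D k K x
    = D 1 x • KaehlerDifferential.D k K (algebraMap L K t) := by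
  let d : Derivation k K (Ω[K⁄k]) := KaehlerDifferential.D k K -
    ((LinearMap.toSpanSingleton K _
      (KaehlerDifferential.D k K (algebraMap L K t))).compDer hD.derivation)
  have hd : ∀ x, d x = KaehlerDifferential.D k K x
      - D 1 x • KaehlerDifferential.D k K (algebraMap L K t) := fun x => rfl
  have h0 := derivation_eq_zero_of_isSeparatingVariable ht d
    (by rw [hd, hD.one_var, one_smul, sub_self])
  have := hd x
  rw [h0] at this
  exact (sub_eq_zero.1 this.symm)

/-- Since dt is a multiple of ds, the `epsilon` in `ordDiff` satisfies its equation; applying the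
derivation `D 1` to that equation shows that its value can only be (ds/dt)⁻¹. -/
theorem ordDiff_eq
    (hres : ∀ x, 0 ≤ P.v x → ∃ c : k, 0 < P.v (x - algebraMap k K c))
    (ht : IsSeparatingVariable F t)
    (hD : IsHasseSystem (algebraMap L K t) D) :
    P.ordDiff (KaehlerDifferential.D k K (algebraMap L K t))
    = P.ord (D 1 P.uniformizer)⁻¹ := by
  have hne := hasse_one_uniformizer_ne_zero hres ht hD
  have hex : ∃ h : K, KaehlerDifferential.D k K (algebraMap L K t)
      = h • KaehlerDifferential.D k K P.uniformizer := by
    refine ⟨(D 1 P.uniformizer)⁻¹, ?_⟩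
    rw [kaehler_D_eq ht hD P.uniformizer, smul_smul, inv_mul_cancel₀ hne, one_smul]
  have hspec := Classical.epsilon_spec hex
  rw [ordDiff]
  congr 1
  have := congrArg hD.derivation.liftKaehlerDifferential hspec
  rw [map_smul, Derivation.liftKaehlerDifferential_comp_D,
    Derivation.liftKaehlerDifferential_comp_D] at this
  have h1 : hD.derivation (algebraMap L K t) = 1 := hD.one_var
  rw [h1, smul_eq_mul] at this
  exact eq_inv_of_mul_eq_one_left this.symm

/-- The determinant formed from the expansions of the functions `g f_i`, in terms of the determinant
formed with the Hasse derivatives of the functions `f_i` with respect to `t`. -/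
theorem algebraMap_det_expand (ht : IsSeparatingVariable F t)
    (hD : IsHasseSystem (algebraMap L K t) D) {r : ℕ} (a b : ℕ)
    (f : Fin (r + 2) → K) (κ : Fin r → ℕ)
    (hκ : StrictMono κ)
    (hmin : ∀ ρ : Fin r → ℕ, StrictMono ρ → (∀ s, ρ s ≤ κ s) → ρ ≠ κ →
      Matrix.det (Matrix.of (Matrix.vecCons (fun i => f i ^ a) (Matrix.vecCons (fun i => f i ^ b)
        (fun (s : Fin r) (i : Fin (r + 2)) => D (ρ s) (f i))))) = 0)
    (g : K) (hg : ∀ i, g * f i ∈ P.valRing) :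
    algebraMap k⟦X⟧ (FractionRing k⟦X⟧) (Matrix.det (Matrix.of
      (Matrix.vecCons (fun i => expand hres ⟨g * f i, hg i⟩ ^ a)
        (Matrix.vecCons (fun i => expand hres ⟨g * f i, hg i⟩ ^ b)
          (fun (s : Fin r) (i : Fin (r + 2)) =>
            hasseSeries (κ s) (expand hres ⟨g * f i, hg i⟩))))))
    = toLaurent hres (Matrix.det (Matrix.of (Matrix.vecCons (fun i => f i ^ a)
        (Matrix.vecCons (fun i => f i ^ b)
          (fun (s : Fin r) (i : Fin (r + 2)) => D (κ s) (f i)))))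
        * ((D 1 P.uniformizer)⁻¹ ^ (∑ s, κ s) * g ^ (a + b + r))) := by
  set ι := toLaurent hres
  set A := algebraMap k⟦X⟧ (FractionRing k⟦X⟧)
  set W := increment hres (algebraMap L K t)
  -- The determinant as an alternating function of the derivative rows, with the two Frobenius rows
  -- frozen; `hmin` is then the vanishing required by `map_triangular`.
  let G : (Fin (r + 2) → FractionRing k⟦X⟧) [⋀^Fin r]→ₗ[FractionRing k⟦X⟧] FractionRing k⟦X⟧ :=
    (Matrix.detRowAlternating.curryLeft (fun i => ι (f i) ^ a)).curryLeft (fun i => ι (f i) ^ b)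
  have hG : ∀ w, G w = Matrix.det (Matrix.of (Matrix.vecCons (fun i => ι (f i) ^ a)
      (Matrix.vecCons (fun i => ι (f i) ^ b) w))) := fun w => rfl
  have hGι : ∀ ρ : Fin r → ℕ, G (fun s i => ι (D (ρ s) (f i)))
      = ι (Matrix.det (Matrix.of (Matrix.vecCons (fun i => f i ^ a)
        (Matrix.vecCons (fun i => f i ^ b)
          (fun (s : Fin r) (i : Fin (r + 2)) => D (ρ s) (f i)))))) := by
    intro ρ
    rw [hG, RingHom.map_det]
    congr 1
    ext i j
    refine Fin.cases ?_ (fun i => Fin.cases ?_ (fun i => ?_) i) i <;> simp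
  have htri := G.map_triangular (fun l i => ι (D l (f i)))
    (fun l i => coeff l (localTaylor hres (g * f i)))
    (fun l i => coeff l (localTaylor hres g * W ^ i)) ?_ κ hκ ?_
  · have hrows : A (Matrix.det (Matrix.of
        (Matrix.vecCons (fun i => expand hres ⟨g * f i, hg i⟩ ^ a)
          (Matrix.vecCons (fun i => expand hres ⟨g * f i, hg i⟩ ^ b)
            (fun (s : Fin r) (i : Fin (r + 2)) =>
              hasseSeries (κ s) (expand hres ⟨g * f i, hg i⟩))))))
        = ι g ^ a * (ι g ^ b * G (fun s i => coeff (κ s) (localTaylor hres (g * f i)))) := by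
      have hA : ∀ i, A (expand hres ⟨g * f i, hg i⟩) = ι g * ι (f i) := fun i => by
        rw [← map_mul]; exact (toLaurent_coe hres ⟨g * f i, hg i⟩).symm
      have hscale : ∀ w, Matrix.det (Matrix.of (Matrix.vecCons (fun i => (ι g * ι (f i)) ^ a)
          (Matrix.vecCons (fun i => (ι g * ι (f i)) ^ b) w))) = ι g ^ a * (ι g ^ b * G w) := by
        intro w
        have h : (Matrix.detRowAlternating.curryLeft (ι g ^ a • fun i => ι (f i) ^ a)).curryLeft
            (ι g ^ b • fun i => ι (f i) ^ b) w = ι g ^ a * (ι g ^ b * G w) := by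
          rw [map_smul (Matrix.detRowAlternating.curryLeft), AlternatingMap.curryLeft_smul,
            LinearMap.smul_apply, map_smul]
          rfl
        rw [← h]
        simp only [mul_pow]
        rfl
      rw [← hscale, RingHom.map_det]
      congr 1
      ext i j
      refine Fin.cases ?_ (fun i => Fin.cases ?_ (fun i => ?_) i) i
      · simp [hA]
      · simp [hA]
      · exact (coeff_localTaylor_coe hres ⟨g * f j, hg j⟩ (κ i)).symm
    -- The r diagonal coefficients g·(dt/ds)^{κ_s} give g^r and the exponent Σκ; the Frobenius rows
    -- contribute g^a and g^b.
    rw [hrows, htri, hGι, smul_eq_mul, map_mul, map_mul, map_pow, map_pow]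
    simp only [coeff_mul_pow_self _ _ (constantCoeff_increment hres (algebraMap L K t)),
      constantCoeff_localTaylor, coeff_one_increment hres ht hD, Finset.prod_mul_distrib,
      Finset.prod_const, Finset.card_univ, Fintype.card_fin, Finset.prod_pow_eq_pow_sum, W]
    ring
  · intro l
    ext i
    rw [Finset.sum_apply]
    exact coeff_localTaylor_mul hres ht hD g (f i) l
  · intro ρ hρ hle hne
    rw [hGι, hmin ρ hρ hle hne, map_zero]

end Compare

end Local

end Place

/-! ### Powers of Frobenius and the Moore determinant -/

section FiniteField

theorem frobenius_pow_apply {F : Type*} [Field F] [Fintype F] {R : Type*} [CommRing R]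
    [Algebra F R] (n : ℕ) (c : R) :
    (FiniteField.frobeniusAlgHom F R ^ n) c = c ^ (Nat.card F ^ n) := by
  rw [AlgHom.coe_pow, FiniteField.coe_frobeniusAlgHom, pow_iterate, Nat.card_eq_fintype_card]

theorem pow_pow_mul_eq {k : Type*} [Monoid k] {c : k} {q n : ℕ} (h : c ^ (q ^ n) = c) (m : ℕ) :
    c ^ (q ^ (n * m)) = c := by
  induction m with
  | zero => simp
  | succ m ih => rw [Nat.mul_succ, pow_add, pow_mul, ih, h]

variable {F k : Type*} [Field F] [Finite F] [Field k] [Algebra F k]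

variable (F) in
theorem exists_pow_card_pow_eq [Algebra.IsAlgebraic F k] (S : Finset k) :
    ∃ M : ℕ, M ≠ 0 ∧ ∀ c ∈ S, c ^ (Nat.card F ^ M) = c := by
  classical
  have single : ∀ c : k, ∃ n : ℕ, n ≠ 0 ∧ c ^ (Nat.card F ^ n) = c := by
    intro c
    have hc : IsIntegral F c := (Algebra.IsAlgebraic.isAlgebraic c).isIntegral
    have := IntermediateField.adjoin.finiteDimensional hc
    have : Finite (IntermediateField.adjoin F {c}) := Module.finite_of_finite F
    have := Fintype.ofFinite (IntermediateField.adjoin F {c})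
    refine ⟨Module.finrank F (IntermediateField.adjoin F {c}), Module.finrank_pos.ne', ?_⟩
    have h := FiniteField.pow_card (IntermediateField.AdjoinSimple.gen F c)
    rw [← Nat.card_eq_fintype_card,
      Module.natCard_eq_pow_finrank (K := F) (V := IntermediateField.adjoin F {c})] at h
    simpa using congrArg (algebraMap (IntermediateField.adjoin F {c}) k) h
  choose n hn hc using single
  refine ⟨∏ c ∈ S, n c, Finset.prod_ne_zero_iff.2 fun c _ => hn c, fun c hcS => ?_⟩
  rw [← Finset.mul_prod_erase S n hcS]
  exact pow_pow_mul_eq (hc c) _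

/-- The Moore determinant of linearly independent elements over a finite field is nonzero. -/
theorem moore_det_ne_zero {n : ℕ} {c : Fin n → k} (hc : LinearIndependent F c) :
    (Matrix.of fun i j : Fin n => c i ^ (Nat.card F ^ (j : ℕ))).det ≠ 0 := by
  classical
  have := Fintype.ofFinite F
  intro hdet
  obtain ⟨w, hw0, hw⟩ := Matrix.exists_mulVec_eq_zero_iff.2 hdet
  have hq : 1 < Nat.card F := Finite.one_lt_card
  -- A kernel vector gives an additive polynomial of degree at most q^{n-1} that vanishes on the
  -- F-span of the c_i, a set of q^n elements.
  let p : Polynomial k := ∑ j : Fin n, Polynomial.monomial (Nat.card F ^ (j : ℕ)) (w j)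
  have hp : p = 0 := by
    refine Polynomial.eq_zero_of_natDegree_lt_card_of_eval_eq_zero p
      (f := fun a : Fin n → F => ∑ i, a i • c i) ?_ ?_ ?_
    · intro a b hab
      have h0 := Fintype.linearIndependent_iff.1 hc (a - b) (by
        simpa [sub_smul, sub_eq_zero] using hab)
      exact funext fun i => sub_eq_zero.1 (h0 i)
    · intro a
      have key : ∀ j : Fin n, (∑ i, a i • c i) ^ (Nat.card F ^ (j : ℕ))
          = ∑ i, a i • c i ^ (Nat.card F ^ (j : ℕ)) := fun j => by
        simp only [← frobenius_pow_apply (F := F), map_sum, map_smul]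
      simp only [p, Polynomial.eval_finsetSum, Polynomial.eval_monomial, key, Finset.mul_sum]
      rw [Finset.sum_comm]
      refine Finset.sum_eq_zero fun i _ => ?_
      have hi := congrFun hw i
      simp only [Matrix.mulVec, dotProduct, Matrix.of_apply, Pi.zero_apply] at hi
      calc ∑ j : Fin n, w j * a i • c i ^ Nat.card F ^ (j : ℕ)
          = a i • ∑ j : Fin n, c i ^ Nat.card F ^ (j : ℕ) * w j := by
            rw [Finset.smul_sum]
            exact Finset.sum_congr rfl fun j _ => by rw [mul_smul_comm, mul_comm]
        _ = 0 := by rw [hi, smul_zero]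
    · rw [Fintype.card_fun, Fintype.card_fin, ← Nat.card_eq_fintype_card]
      rcases n with _ | n
      · exact absurd (Subsingleton.elim w 0) hw0
      · refine lt_of_le_of_lt (Polynomial.natDegree_sum_le_of_forall_le
          (n := Nat.card F ^ n) _ _ fun j _ => ?_) (Nat.pow_lt_pow_right hq n.lt_succ_self)
        exact (Polynomial.natDegree_monomial_le _).trans
          (Nat.pow_le_pow_right hq.le (Nat.lt_succ_iff.1 j.2))
  refine hw0 (funext fun j => ?_)
  have := congrArg (fun p => p.coeff (Nat.card F ^ (j : ℕ))) hp
  simp only [p, Polynomial.finsetSum_coeff, Polynomial.coeff_monomial,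
    Polynomial.coeff_zero] at this
  rw [Finset.sum_eq_single j] at this
  · simpa using this
  · intro i _ hij
    rw [if_neg]
    intro h
    exact hij (Fin.ext (Nat.pow_right_injective hq h))
  · simp

end FiniteField

/-! ### Frobenius acting on the constants of the function field -/

section ConstFrob

theorem exists_linearIndependent_repr (F k L : Type*) {K : Type*} [Field F] [Field k] [Field L]
    [Field K] [Algebra F k] [Algebra F L] [Algebra F K] [Algebra k K] [Algebra L K]
    [IsScalarTower F k K] [IsScalarTower F L K] [Algebra.IsPushout F k L K] (x : K) :
    ∃ (n : ℕ) (c : Fin n → k) (l : Fin n → L),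
    LinearIndependent F c ∧ x = ∑ i, algebraMap k K (c i) * algebraMap L K (l i) := by
  have hb := (Algebra.IsPushout.symm (inferInstance : Algebra.IsPushout F k L K)).out
  let b := Module.Basis.ofVectorSpace F k
  let B := hb.basis b
  have hx := B.linearCombination_repr x
  let s := (B.repr x).support
  let e := s.equivFin.symm
  refine ⟨s.card, fun i => b (e i), fun i => B.repr x (e i),
    b.linearIndependent.comp _ (Subtype.val_injective.comp e.injective), ?_⟩
  rw [Equiv.sum_comp e (fun i : s => algebraMap k K (b i) * algebraMap L K (B.repr x i)),
    Finset.sum_coe_sort s (fun i => algebraMap k K (b i) * algebraMap L K (B.repr x i))]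
  conv_lhs => rw [← hx, Finsupp.linearCombination_apply, Finsupp.sum]
  refine Finset.sum_congr rfl fun i _ => ?_
  rw [Algebra.smul_def, mul_comm]
  congr 1
  exact hb.basis_apply b i

variable (F k L : Type*) {K : Type*} [Field F] [Finite F] [Field k] [Field L] [Field K]
    [Algebra F k] [Algebra F L] [Algebra F K] [Algebra k K] [Algebra L K]
    [IsScalarTower F k K] [IsScalarTower F L K] [Algebra.IsPushout F k L K]

/-- The endomorphism of the function field over `k` which is the identity on the functions defined
over `F` and the `n`-th power of the Frobenius of `F` on the constants. -/
def constFrob (n : ℕ) : K →ₐ[F] K :=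
  letI := Fintype.ofFinite F
  Algebra.pushoutDesc K
    ((IsScalarTower.toAlgHom F k K).comp (FiniteField.frobeniusAlgHom F k ^ n))
    (IsScalarTower.toAlgHom F L K) fun _ _ => mul_comm _ _

theorem constFrob_const (n : ℕ) (c : k) :
    constFrob F k L n (algebraMap k K c) = algebraMap k K (c ^ (Nat.card F ^ n)) := by
  let := Fintype.ofFinite F
  rw [constFrob, Algebra.pushoutDesc_left, AlgHom.comp_apply, frobenius_pow_apply]
  rfl

theorem constFrob_base (n : ℕ) (l : L) :
    constFrob F k L n (algebraMap L K l) = algebraMap L K l := by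
  rw [constFrob, Algebra.pushoutDesc_right]
  rfl

theorem constFrob_surjective [IsAlgClosed k] (n : ℕ) :
    Function.Surjective (constFrob F k L n : K → K) := by
  intro x
  refine pushout_induction F k L (motive := fun x => ∃ y, constFrob F k L n y = x) x ?_ ?_ ?_
  · exact fun l => ⟨_, constFrob_base F k L n l⟩
  · rintro c _ ⟨y, rfl⟩
    obtain ⟨d, rfl⟩ := IsAlgClosed.exists_pow_nat_eq c
      (n := Nat.card F ^ n) (pow_pos Nat.card_pos n)
    exact ⟨algebraMap k K d * y, by rw [map_mul, constFrob_const]⟩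
  · rintro _ _ ⟨x, rfl⟩ ⟨y, rfl⟩
    exact ⟨x + y, map_add _ _ _⟩

variable {F k L}

theorem constFrob_sum (n : ℕ) {ι : Type*} (s : Finset ι) (c : ι → k) (l : ι → L) :
    constFrob F k L n (∑ i ∈ s, algebraMap k K (c i) * algebraMap L K (l i))
      = ∑ i ∈ s, algebraMap k K (c i ^ (Nat.card F ^ n)) * algebraMap L K (l i) := by
  simp only [map_sum, map_mul, constFrob_const, constFrob_base]

/-- Only finitely many constants occur in x, and some power of Frobenius fixes them all. -/
theorem exists_period_constFrob [Algebra.IsAlgebraic F k] (x : K) :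
    ∃ N : ℕ, N ≠ 0 ∧ ∀ j, constFrob F k L j x = constFrob F k L (j % N) x := by
  classical
  obtain ⟨n, c, l, -, rfl⟩ := exists_linearIndependent_repr F k L x
  obtain ⟨N, hN, hc⟩ := exists_pow_card_pow_eq F (Finset.univ.image c)
  refine ⟨N, hN, fun j => ?_⟩
  rw [constFrob_sum, constFrob_sum]
  refine Finset.sum_congr rfl fun i _ => ?_
  have h := pow_pow_mul_eq (hc (c i) (Finset.mem_image_of_mem c (Finset.mem_univ i))) (j / N)
  conv_lhs => rw [← Nat.div_add_mod j N, pow_add, pow_mul, h]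

end ConstFrob

/-! ### Rational places are fixed by Frobenius -/

namespace Place

section Rational

variable {k K : Type*} [Field k] [Field K] [Algebra k K] (P : Place k K)

/-- The function `z ^ Q / (z ^ Q - z + 1)` is regular where `z` has a pole or a value fixed by
the `Q`-th power map, and vanishes only where `z` does. -/
theorem v_artinSchreier_quotient {Q : ℕ} (hQ : 2 ≤ Q) {z : K}
    (hz : 0 ≤ P.v z → ∃ ρ : k, ρ ^ Q = ρ ∧ 0 < P.v (z - algebraMap k K ρ)) :
    0 ≤ P.v (z ^ Q / (z ^ Q - z + 1)) ∧ (0 < P.v (z ^ Q / (z ^ Q - z + 1)) ↔ 0 < P.v z) := by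
  by_cases h : 0 ≤ P.v z
  · obtain ⟨ρ, hρ, hzρ⟩ := hz h
    have hpow : 0 < P.v (z ^ Q - algebraMap k K ρ ^ Q) := by
      obtain ⟨e, he⟩ := sub_dvd_pow_sub_pow (⟨z, h⟩ : P.valRing)
        ⟨algebraMap k K ρ, P.zero_le_v_algebraMap ρ⟩ Q
      have he' : z ^ Q - algebraMap k K ρ ^ Q = (z - algebraMap k K ρ) * (e : K) :=
        congrArg Subtype.val he
      rw [he', mul_comm]
      exact P.v_mul_pos e.2 hzρ
    -- The value of z^Q − z at P is ρ^Q − ρ = 0, so the denominator takes the value 1.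
    have hden : P.v (z ^ Q - z + 1) = 0 := by
      have : z ^ Q - z + 1 = 1 + ((z ^ Q - algebraMap k K ρ ^ Q) + -(z - algebraMap k K ρ)) := by
        rw [← map_pow, hρ]; ring
      rw [this]
      refine P.v_add_eq_zero P.v.map_one (AddValuation.map_lt_add P.v hpow ?_)
      rwa [AddValuation.map_neg]
    have hv : P.v (z ^ Q / (z ^ Q - z + 1)) = P.v (z ^ Q) := by
      rw [div_eq_mul_inv, AddValuation.map_mul, P.v_inv_of_v_eq_zero hden, add_zero]
    rw [hv]
    refine ⟨P.zero_le_v_pow h Q, fun h' => ?_, fun h' => P.v_pow_pos h' (by omega)⟩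
    refine lt_of_le_of_ne h fun h0 => ?_
    rw [AddValuation.map_pow, ← h0, smul_zero] at h'
    exact lt_irrefl _ h'
  · rw [not_le] at h
    have hz0 : z ≠ 0 := by
      rintro rfl
      rw [AddValuation.map_zero] at h
      exact absurd h (by simp)
    have hinv : 0 < P.v z⁻¹ := by
      rw [P.v_eq_ord hz0] at h
      rw [P.v_eq_ord (inv_ne_zero hz0), P.ord_inv hz0]
      have : P.ord z < 0 := by exact_mod_cast h
      have : 0 < -P.ord z := by omega
      exact_mod_cast this
    have hfac : z ^ Q / (z ^ Q - z + 1) = (1 + (z⁻¹ ^ Q + -z⁻¹ ^ (Q - 1)))⁻¹ := by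
      have : z ^ Q - z + 1 = z ^ Q * (1 + (z⁻¹ ^ Q + -z⁻¹ ^ (Q - 1))) := by
        obtain ⟨R, rfl⟩ : ∃ R, Q = R + 1 := ⟨Q - 1, by omega⟩
        have e₁ : z ^ (R + 1) * z⁻¹ ^ (R + 1) = 1 := by
          rw [← mul_pow, mul_inv_cancel₀ hz0, one_pow]
        have e₂ : z ^ (R + 1) * z⁻¹ ^ R = z := by
          rw [pow_succ, mul_right_comm, ← mul_pow, mul_inv_cancel₀ hz0, one_pow, one_mul]
        rw [Nat.add_sub_cancel, mul_add, mul_add, mul_neg, e₁, e₂]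
        ring
      rw [this, div_mul_eq_div_div, div_self (pow_ne_zero Q hz0), one_div]
    have hunit : P.v (1 + (z⁻¹ ^ Q + -z⁻¹ ^ (Q - 1))) = 0 := by
      refine P.v_add_eq_zero P.v.map_one (AddValuation.map_lt_add P.v ?_ ?_)
      · exact P.v_pow_pos hinv (by omega)
      · rw [AddValuation.map_neg]
        exact P.v_pow_pos hinv (by omega)
    rw [hfac, P.v_inv_of_v_eq_zero hunit]
    exact ⟨le_rfl, fun h' => absurd h' (lt_irrefl _), fun h' => absurd h' h.not_gt⟩

variable {P} {F L : Type*} [Field F] [Finite F] [Field L]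
    [Algebra F k] [Algebra F L] [Algebra F K] [Algebra L K]
    [IsScalarTower F k K] [IsScalarTower F L K] [Algebra.IsPushout F k L K]

/-- Write y = Σ c_i l_i with the c_i independent over F and l_i in L. Inverting the Moore matrix
expresses each l_i through the conjugates of y, so the l_i are regular at P, with values ρ_i fixed
by the q^d-th power. Raising Σ c_i ρ_i = 0 to that power gives Σ c_i^{q^d} ρ_i = 0, the value of the
conjugate. -/
theorem v_constFrob_pos_of_regular {d : ℕ} (hrat : P.IsRational F L d) {y : K}
    (hreg : ∀ j, 0 ≤ P.v (constFrob F k L j y)) (hy : 0 < P.v y) :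
    0 < P.v (constFrob F k L d y) := by
  obtain ⟨n, c, l, hc, rfl⟩ := exists_linearIndependent_repr F k L y
  have hl : ∀ i, 0 ≤ P.v (algebraMap L K (l i)) := by
    set M : Matrix (Fin n) (Fin n) k :=
      (Matrix.of fun i j : Fin n => c i ^ (Nat.card F ^ (j : ℕ))).transpose
    have hM : IsUnit M.det := by
      rw [Matrix.det_transpose]
      exact (moore_det_ne_zero hc).isUnit
    intro i
    have hmul : M⁻¹ * M = 1 := Matrix.nonsing_inv_mul _ hM
    have hli : algebraMap L K (l i) = ∑ j : Fin n, algebraMap k K (M⁻¹ i j) *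
        constFrob F k L j (∑ i, algebraMap k K (c i) * algebraMap L K (l i)) := by
      simp only [constFrob_sum, Finset.mul_sum]
      rw [Finset.sum_comm]
      have : ∀ i', ∑ j : Fin n, algebraMap k K (M⁻¹ i j) *
          (algebraMap k K (c i' ^ Nat.card F ^ (j : ℕ)) * algebraMap L K (l i'))
          = algebraMap k K ((1 : Matrix (Fin n) (Fin n) k) i i') * algebraMap L K (l i') := by
        intro i'
        rw [← hmul, Matrix.mul_apply, map_sum, Finset.sum_mul]
        refine Finset.sum_congr rfl fun j _ => ?_
        rw [map_mul, mul_assoc]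
        rfl
      simp only [this, Matrix.one_apply]
      rw [Finset.sum_eq_single i]
      · simp
      · intro j _ hj
        simp [hj.symm]
      · simp
    rw [hli]
    exact AddValuation.map_le_sum P.v fun j _ =>
      P.zero_le_v_mul (P.zero_le_v_algebraMap _) (hreg j)
  choose ρ hρ hlρ using fun i => hrat (l i) (hl i)
  have hsum : ∑ i, c i * ρ i = 0 := by
    apply P.eq_zero_of_v_algebraMap_pos
    have : algebraMap k K (∑ i, c i * ρ i) = (∑ i, algebraMap k K (c i) * algebraMap L K (l i))
        + -∑ i, algebraMap k K (c i) * (algebraMap L K (l i) - algebraMap k K (ρ i)) := by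
      rw [map_sum, ← sub_eq_add_neg, ← Finset.sum_sub_distrib]
      refine Finset.sum_congr rfl fun i _ => ?_
      rw [map_mul]
      ring
    rw [this]
    refine AddValuation.map_lt_add P.v hy ?_
    rw [AddValuation.map_neg]
    exact P.v_sum_pos _ _ fun i _ => P.v_mul_pos (P.zero_le_v_algebraMap _) (hlρ i)
  have hzero : ∑ i, algebraMap k K (c i ^ (Nat.card F ^ d)) * algebraMap k K (ρ i) = 0 := by
    have := congrArg (constFrob F k L d) (congrArg (algebraMap k K) hsum)
    rw [map_zero, map_zero, constFrob_const] at this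
    have hfr : (∑ i, c i * ρ i) ^ (Nat.card F ^ d)
        = ∑ i, c i ^ (Nat.card F ^ d) * ρ i := by
      let := Fintype.ofFinite F
      rw [← frobenius_pow_apply (F := F), map_sum]
      refine Finset.sum_congr rfl fun i _ => ?_
      rw [frobenius_pow_apply, mul_pow, hρ]
    rw [hfr] at this
    simpa using this
  have hfin : constFrob F k L d (∑ i, algebraMap k K (c i) * algebraMap L K (l i))
      = ∑ i, algebraMap k K (c i ^ (Nat.card F ^ d))
        * (algebraMap L K (l i) - algebraMap k K (ρ i)) := by
    rw [constFrob_sum, ← sub_zero (∑ i, _ * algebraMap L K (l i)), ← hzero,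
      ← Finset.sum_sub_distrib]
    exact Finset.sum_congr rfl fun i _ => by ring
  rw [hfin]
  exact P.v_sum_pos _ _ fun i _ => P.v_mul_pos (P.zero_le_v_algebraMap _) (hlρ i)

/-- Conjugates of x may have poles at P, so x is replaced by y = x^Q/(x^Q − x + 1), all of whose
conjugates are regular at P. There are finitely many conjugates, so Q can be chosen such that the
Q-th power fixes all their finite values at P; then a conjugate of y vanishes at P exactly when that
of x does. -/
theorem v_constFrob_pos [Algebra.IsAlgebraic F k]
    (hres : ∀ x, 0 ≤ P.v x → ∃ c : k, 0 < P.v (x - algebraMap k K c))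
    {d : ℕ} (hrat : P.IsRational F L d) {x : K} (hx : 0 < P.v x) :
    0 < P.v (constFrob F k L d x) := by
  classical
  obtain ⟨N, hN, hper⟩ := exists_period_constFrob (F := F) (k := k) (L := L) x
  have hex : ∀ j : ℕ, ∃ ρ : k, 0 ≤ P.v (constFrob F k L j x) →
      0 < P.v (constFrob F k L j x - algebraMap k K ρ) := by
    intro j
    by_cases h : 0 ≤ P.v (constFrob F k L j x)
    · obtain ⟨ρ, hρ⟩ := hres _ h
      exact ⟨ρ, fun _ => hρ⟩
    · exact ⟨0, fun h' => absurd h' h⟩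
  choose ρ hρ using hex
  obtain ⟨M, hM, hfix⟩ := exists_pow_card_pow_eq F ((Finset.range N).image ρ)
  have hQ : 2 ≤ Nat.card F ^ M := Nat.one_lt_pow hM Finite.one_lt_card
  have hz : ∀ j, 0 ≤ P.v (constFrob F k L j x) → ∃ ρ : k, ρ ^ (Nat.card F ^ M) = ρ ∧
      0 < P.v (constFrob F k L j x - algebraMap k K ρ) := by
    intro j hj
    rw [hper j] at hj ⊢
    refine ⟨ρ (j % N), hfix _ (Finset.mem_image_of_mem ρ
      (Finset.mem_range.2 (Nat.mod_lt j (Nat.pos_of_ne_zero hN)))), hρ _ hj⟩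
  set y := x ^ (Nat.card F ^ M) / (x ^ (Nat.card F ^ M) - x + 1) with hy
  have hyj : ∀ j, constFrob F k L j y = constFrob F k L j x ^ (Nat.card F ^ M) /
      (constFrob F k L j x ^ (Nat.card F ^ M) - constFrob F k L j x + 1) := by
    intro j
    simp only [hy, map_div₀, map_add, map_sub, map_pow, map_one]
  have hfrob0 : constFrob F k L 0 x = x := by
    obtain ⟨n, c, l, -, rfl⟩ := exists_linearIndependent_repr F k L x
    rw [constFrob_sum]
    simp
  have key := v_constFrob_pos_of_regular hrat (y := y)
    (fun j => by rw [hyj]; exact (P.v_artinSchreier_quotient hQ (hz j)).1)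
    (by
      have h0 := hz 0
      rw [hfrob0] at h0
      exact (P.v_artinSchreier_quotient hQ h0).2.2 hx)
  rw [hyj] at key
  exact (P.v_artinSchreier_quotient hQ (hz d)).2.1 key

/-- A rational point is fixed by the Frobenius of the constants. -/
theorem v_constFrob [IsAlgClosed k] [Algebra.IsAlgebraic F k]
    (hres : ∀ x, 0 ≤ P.v x → ∃ c : k, 0 < P.v (x - algebraMap k K c))
    {d : ℕ} (hrat : P.IsRational F L d) (x : K) : P.v (constFrob F k L d x) = P.v x := by
  by_cases hx0 : x = 0
  · rw [hx0, map_zero]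
  have hpos := fun (x : K) (hx : 0 < P.v x) => v_constFrob_pos hres hrat hx
  have hunit : ∀ x : K, P.v x = 0 → P.v (constFrob F k L d x) = 0 := by
    intro x hx
    obtain ⟨c, hc⟩ := hres x hx.ge
    have hc0 : c ≠ 0 := by
      rintro rfl
      rw [map_zero, sub_zero, hx] at hc
      exact lt_irrefl _ hc
    have : constFrob F k L d x = algebraMap k K (c ^ (Nat.card F ^ d))
        + constFrob F k L d (x - algebraMap k K c) := by
      rw [map_sub, constFrob_const]
      ring
    rw [this]
    exact P.v_add_eq_zero (P.v_algebraMap _ (pow_ne_zero _ hc0)) (hpos _ hc)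
  have hinj : ∀ {x : K}, x ≠ 0 → constFrob F k L d x ≠ 0 := fun h => by simpa using h
  set e := P.ord (constFrob F k L d P.uniformizer) with he
  have hord : ∀ x : K, x ≠ 0 → P.ord (constFrob F k L d x) = e * P.ord x := by
    intro x hx
    have hs := P.uniformizer_ne_zero
    have hnat : ∀ (x : K) (n : ℕ), x ≠ 0 → P.ord x = n →
        P.ord (constFrob F k L d x) = e * n := by
      intro x n hx hn
      have hsn := pow_ne_zero n hs
      have h1 : P.v (x * (P.uniformizer ^ n)⁻¹) = 0 := by
        rw [P.v_eq_ord (mul_ne_zero hx (inv_ne_zero hsn)), P.ord_mul hx (inv_ne_zero hsn),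
          P.ord_inv hsn, P.ord_pow hs, P.ord_uniformizer, hn]
        simp
      have h2 := hunit _ h1
      have hx' : x = x * (P.uniformizer ^ n)⁻¹ * P.uniformizer ^ n := by field_simp
      have hne := mul_ne_zero hx (inv_ne_zero hsn)
      rw [P.v_eq_ord (hinj hne)] at h2
      have h3 : P.ord (constFrob F k L d (x * (P.uniformizer ^ n)⁻¹)) = 0 := by exact_mod_cast h2
      conv_lhs => rw [hx']
      rw [map_mul, P.ord_mul (hinj hne) (hinj hsn), h3, map_pow, P.ord_pow (hinj hs), ← he]
      ring
    rcases Int.eq_nat_or_neg (P.ord x) with ⟨n, hn | hn⟩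
    · rw [hn]; exact hnat x n hx hn
    · have h1 := hnat x⁻¹ n (inv_ne_zero hx) (by rw [P.ord_inv hx, hn, neg_neg])
      rw [map_inv₀, P.ord_inv (hinj hx)] at h1
      rw [hn, mul_neg, ← h1, neg_neg]
  -- The conjugated valuation is e times the original one; surjectivity makes e a divisor of 1.
  have he1 : e = 1 := by
    obtain ⟨z, hz⟩ := constFrob_surjective F k L (K := K) d P.uniformizer
    have hz0 : z ≠ 0 := by
      rintro rfl
      rw [map_zero] at hz
      exact P.uniformizer_ne_zero hz.symm
    have h1 := hord z hz0
    rw [hz, P.ord_uniformizer] at h1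
    have hepos : 0 < e := by
      have := hpos _ P.v_uniformizer_pos
      rw [P.v_eq_ord (hinj P.uniformizer_ne_zero)] at this
      exact_mod_cast this
    exact Int.eq_one_of_mul_eq_one_right hepos.le h1.symm
  rw [P.v_eq_ord (hinj hx0), P.v_eq_ord hx0, hord x hx0, he1, one_mul]

/-- Conjugation raises the constants a_i to the power q^d and fixes the f_i, turning the left-hand
sum into the q^d-th power of Σ a_i f_i without changing its valuation. -/
theorem v_sum_pow_of_isRational [IsAlgClosed k] [Algebra.IsAlgebraic F k]
    (hres : ∀ x, 0 ≤ P.v x → ∃ c : k, 0 < P.v (x - algebraMap k K c))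
    {d : ℕ} (hrat : P.IsRational F L d) {ι : Type*} (s : Finset ι) (a : ι → k) (f : ι → L) :
    P.v (∑ i ∈ s, algebraMap k K (a i) * algebraMap L K (f i) ^ (Nat.card F ^ d))
      = P.v ((∑ i ∈ s, algebraMap k K (a i) * algebraMap L K (f i)) ^ (Nat.card F ^ d)) := by
  rw [← v_constFrob hres hrat]
  congr 1
  simp only [← map_pow (algebraMap L K)]
  rw [constFrob_sum]
  let := Fintype.ofFinite F
  rw [← frobenius_pow_apply (F := F), map_sum]
  refine Finset.sum_congr rfl fun i _ => ?_
  rw [frobenius_pow_apply, mul_pow, map_pow, map_pow]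

end Rational

end Place

/-! ### Laplace expansion along the two Frobenius rows -/

section Determinant

open PowerSeries

variable {k : Type*} [Field k] {r : ℕ}

/-- Multiplication by X^i makes the i-th Hasse derivative diagonal on monomials, hence the factors
X^{κ_s} put on the rows below. -/
theorem coeff_X_pow_mul_hasseSeries (i n : ℕ) (G : k⟦X⟧) :
    coeff n (X ^ i * hasseSeries i G) = (n.choose i : k) * coeff n G := by
  rw [coeff_X_pow_mul']
  split_ifs with h
  · rw [coeff_hasseSeries, Nat.sub_add_cancel h]
  · rw [Nat.choose_eq_zero_of_lt (not_le.1 h), Nat.cast_zero, zero_mul]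

theorem exists_X_pow_mul_hasseSeries_eq {i a : ℕ} {G : k⟦X⟧} (hG : X ^ a ∣ G) :
    ∃ B : k⟦X⟧, X ^ i * hasseSeries i G = X ^ a * B
      ∧ constantCoeff B = (a.choose i : k) * coeff a G := by
  have hdvd : X ^ a ∣ X ^ i * hasseSeries i G := by
    rw [X_pow_dvd_iff] at hG ⊢
    intro n hn
    rw [coeff_X_pow_mul_hasseSeries, hG n hn, mul_zero]
  obtain ⟨B, hB⟩ := hdvd
  refine ⟨B, hB, ?_⟩
  rw [← coeff_X_pow_mul_hasseSeries, hB, coeff_X_pow_mul', if_pos le_rfl, Nat.sub_self,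
    coeff_zero_eq_constantCoeff_apply]

/-- A minor of the Hasse derivatives, up to its lowest term. -/
theorem exists_det_hasseSeries_eq (κ a : Fin r → ℕ) (G : Fin r → k⟦X⟧)
    (hG : ∀ i, X ^ a i ∣ G i) :
    ∃ B : k⟦X⟧, Matrix.det (Matrix.of fun s i => X ^ κ s * hasseSeries (κ s) (G i))
        = X ^ (∑ i, a i) * B
      ∧ constantCoeff B = (∏ i, coeff (a i) (G i)) * ((binomDet a κ : ℤ) : k) := by
  choose B hB hB0 using fun s i => exists_X_pow_mul_hasseSeries_eq (i := κ s) (hG i)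
  refine ⟨Matrix.det (Matrix.of B), ?_, ?_⟩
  · simp only [hB]
    have := Matrix.det_mul_row (fun i => (X : k⟦X⟧) ^ a i) (Matrix.of B)
    rw [Finset.prod_pow_eq_pow_sum] at this
    exact this
  · rw [RingHom.map_det, binomDet, ← eq_intCast (Int.castRingHom k), RingHom.map_det,
      ← Matrix.det_transpose
      ((Int.castRingHom k).mapMatrix _), ← Matrix.det_mul_row]
    congr 1
    ext s i
    simp [hB0, mul_comm]

theorem det_vecCons_vecCons {R : Type*} [CommRing R] (x y : Fin (r + 2) → R)
    (M : Fin r → Fin (r + 2) → R) :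
    Matrix.det (Matrix.of (Matrix.vecCons x (Matrix.vecCons y M)))
      = ∑ A : Fin (r + 2), ∑ B : Fin (r + 1), (-1) ^ (A : ℕ) * x A * ((-1) ^ (B : ℕ)
        * y (A.succAbove B)
        * Matrix.det (Matrix.of fun s i => M s (A.succAbove (B.succAbove i)))) := by
  rw [Matrix.det_succ_row_zero]
  refine Finset.sum_congr rfl fun A _ => ?_
  rw [Matrix.det_succ_row_zero, Finset.mul_sum]
  rfl

variable {x y G : Fin (r + 2) → k⟦X⟧} {α β j : Fin (r + 2) → ℕ}

/-- In the second alternative one power of X is gained because the lowest coefficient of the minor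
is a multiple of the binomial determinant. -/
theorem X_pow_dvd_laplace_term (κ : Fin r → ℕ) (hx : ∀ c, X ^ α c ∣ x c) (hy : ∀ c, X ^ β c ∣ y c)
    (hG : ∀ c, X ^ j c ∣ G c) {N : ℕ} (A : Fin (r + 2)) (B : Fin (r + 1))
    (h : N ≤ α A + β (A.succAbove B) + ∑ i, j (A.succAbove (B.succAbove i)) ∨
      (N ≤ α A + β (A.succAbove B) + ∑ i, j (A.succAbove (B.succAbove i)) + 1 ∧
        ((binomDet (fun i => j (A.succAbove (B.succAbove i))) κ : ℤ) : k) = 0)) :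
    X ^ N ∣ (-1) ^ (A : ℕ) * x A * ((-1) ^ (B : ℕ) * y (A.succAbove B)
      * Matrix.det (Matrix.of fun s i => X ^ κ s *
        hasseSeries (κ s) (G (A.succAbove (B.succAbove i))))) := by
  obtain ⟨C, hC, hC0⟩ := exists_det_hasseSeries_eq κ
    (fun i => j (A.succAbove (B.succAbove i))) (fun i => G (A.succAbove (B.succAbove i)))
    fun i => hG _
  obtain ⟨x', hx'⟩ := hx A
  obtain ⟨y', hy'⟩ := hy (A.succAbove B)
  have heq : (-1) ^ (A : ℕ) * x A * ((-1) ^ (B : ℕ) * y (A.succAbove B)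
      * Matrix.det (Matrix.of fun s i => X ^ κ s *
        hasseSeries (κ s) (G (A.succAbove (B.succAbove i)))))
      = X ^ (α A + β (A.succAbove B) + ∑ i, j (A.succAbove (B.succAbove i)))
        * (C * ((-1) ^ (A : ℕ) * (-1) ^ (B : ℕ) * x' * y')) := by
    rw [hC, hx', hy', pow_add, pow_add]
    ring
  rw [heq]
  rcases h with h | ⟨h, h0⟩
  · exact (pow_dvd_pow X h).trans (dvd_mul_right _ _)
  · rw [h0, mul_zero] at hC0
    refine (pow_dvd_pow X h).trans ?_
    rw [pow_succ]
    exact mul_dvd_mul_left _ ((X_dvd_iff.2 hC0).mul_right _)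

theorem X_pow_dvd_det (κ : Fin r → ℕ) (hx : ∀ c, X ^ α c ∣ x c) (hy : ∀ c, X ^ β c ∣ y c)
    (hG : ∀ c, X ^ j c ∣ G c) {N : ℕ}
    (h : ∀ (A : Fin (r + 2)) (B : Fin (r + 1)),
      N ≤ α A + β (A.succAbove B) + ∑ i, j (A.succAbove (B.succAbove i)) ∨
      (N ≤ α A + β (A.succAbove B) + ∑ i, j (A.succAbove (B.succAbove i)) + 1 ∧
        ((binomDet (fun i => j (A.succAbove (B.succAbove i))) κ : ℤ) : k) = 0)) :
    X ^ N ∣ Matrix.det (Matrix.of (Matrix.vecCons x (Matrix.vecCons y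
      fun s c => X ^ κ s * hasseSeries (κ s) (G c)))) := by
  rw [det_vecCons_vecCons]
  exact Finset.dvd_sum fun A _ => Finset.dvd_sum fun B _ =>
    X_pow_dvd_laplace_term κ hx hy hG A B (h A B)

/-- If only the first term of the Laplace expansion has the lowest order, it determines whether this
order is attained. -/
theorem not_X_pow_dvd_det (κ : Fin r → ℕ) (hx : ∀ c, X ^ α c ∣ x c) (hy : ∀ c, X ^ β c ∣ y c)
    (hG : ∀ c, X ^ j c ∣ G c) {N : ℕ} (hN : N = α 0 + β 1 + ∑ i : Fin r, j i.succ.succ)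
    (h : ∀ (A : Fin (r + 2)) (B : Fin (r + 1)), ¬ (A = 0 ∧ B = 0) →
      N + 1 ≤ α A + β (A.succAbove B) + ∑ i, j (A.succAbove (B.succAbove i)))
    (hx0 : coeff (α 0) (x 0) ≠ 0) (hy0 : coeff (β 1) (y 1) ≠ 0)
    (hG0 : ∀ c, coeff (j c) (G c) ≠ 0)
    (hb : ((binomDet (fun i : Fin r => j i.succ.succ) κ : ℤ) : k) ≠ 0) :
    ¬ X ^ (N + 1) ∣ Matrix.det (Matrix.of (Matrix.vecCons x (Matrix.vecCons y
      fun s c => X ^ κ s * hasseSeries (κ s) (G c)))) := by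
  rw [det_vecCons_vecCons, ← Fintype.sum_prod_type', ← Finset.add_sum_erase _ _
    (Finset.mem_univ ((0 : Fin (r + 2)), (0 : Fin (r + 1))))]
  intro hdvd
  rw [dvd_add_left] at hdvd
  · obtain ⟨C, hC, hC0⟩ := exists_det_hasseSeries_eq κ
      (fun i : Fin r => j i.succ.succ) (fun i => G i.succ.succ) fun i => hG _
    obtain ⟨x', hx'⟩ := hx 0
    obtain ⟨y', hy'⟩ := hy 1
    have hx'0 : constantCoeff x' ≠ 0 := by
      rwa [hx', coeff_X_pow_mul', if_pos le_rfl, Nat.sub_self,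
        coeff_zero_eq_constantCoeff_apply] at hx0
    have hy'0 : constantCoeff y' ≠ 0 := by
      rwa [hy', coeff_X_pow_mul', if_pos le_rfl, Nat.sub_self,
        coeff_zero_eq_constantCoeff_apply] at hy0
    have hC0' : constantCoeff C ≠ 0 := by
      rw [hC0]
      exact mul_ne_zero (Finset.prod_ne_zero_iff.2 fun i _ => hG0 _) hb
    simp only [Fin.val_zero, pow_zero, one_mul, Fin.zero_succAbove] at hdvd
    rw [Fin.succ_zero_eq_one, hC, hx', hy'] at hdvd
    have heq : X ^ α 0 * x' * (X ^ β 1 * y' * (X ^ (∑ i : Fin r, j i.succ.succ) * C))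
        = X ^ N * (x' * y' * C) := by
      rw [hN, pow_add, pow_add]
      ring
    rw [heq, pow_succ, mul_dvd_mul_iff_left (pow_ne_zero N X_ne_zero), X_dvd_iff, map_mul,
      map_mul] at hdvd
    exact mul_ne_zero (mul_ne_zero hx'0 hy'0) hC0' hdvd
  · refine Finset.dvd_sum fun AB hAB => X_pow_dvd_laplace_term κ hx hy hG AB.1 AB.2
      (Or.inl (h _ _ fun h0 => ?_))
    exact (Finset.mem_erase.1 hAB).1 (Prod.ext h0.1 h0.2)

theorem det_vecCons_sub {R : Type*} [CommRing R] (x y : Fin (r + 2) → R)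
    (M : Fin r → Fin (r + 2) → R) :
    Matrix.det (Matrix.of (Matrix.vecCons (x - y) (Matrix.vecCons y M)))
      = Matrix.det (Matrix.of (Matrix.vecCons x (Matrix.vecCons y M))) := by
  have h : Matrix.detRowAlternating.curryLeft (x - y) (Matrix.vecCons y M)
      = Matrix.detRowAlternating.curryLeft x (Matrix.vecCons y M)
        - Matrix.detRowAlternating.curryLeft y (Matrix.vecCons y M) := by
    rw [map_sub]
    rfl
  have h0 : Matrix.det (Matrix.of (Matrix.vecCons y (Matrix.vecCons y M))) = 0 :=
    Matrix.det_zero_of_row_eq (i := 0) (j := 1) (by simp) rfl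
  refine h.trans ?_
  change _ - Matrix.det (Matrix.of (Matrix.vecCons y (Matrix.vecCons y M))) = _
  rw [h0, sub_zero]
  rfl

/-- Passing to a different basis of the linear series and clearing denominators. -/
theorem det_mul_eq (a b : ℕ) (κ : Fin r → ℕ) (φ : Fin (r + 2) → k⟦X⟧)
    (m : Matrix (Fin (r + 2)) (Fin (r + 2)) k) :
    X ^ (∑ s, κ s) * Matrix.det (Matrix.of (Matrix.vecCons (fun i => φ i ^ a)
        (Matrix.vecCons (fun i => φ i ^ b) (fun s i => hasseSeries (κ s) (φ i))))) * C m.det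
      = Matrix.det (Matrix.of (Matrix.vecCons (fun c => ∑ i, C (m c i) * φ i ^ a)
        (Matrix.vecCons (fun c => ∑ i, C (m c i) * φ i ^ b)
          (fun s c => X ^ κ s * hasseSeries (κ s) (∑ i, C (m c i) * φ i))))) := by
  have hlin : ∀ (s : Fin r) (c : Fin (r + 2)), hasseSeries (κ s) (∑ i, C (m c i) * φ i)
      = ∑ i, C (m c i) * hasseSeries (κ s) (φ i) := by
    intro s c
    have hadd : ∀ t : Finset (Fin (r + 2)), hasseSeries (κ s) (∑ i ∈ t, C (m c i) * φ i)
      = ∑ i ∈ t, C (m c i) * hasseSeries (κ s) (φ i) := by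
      intro t
      induction t using Finset.cons_induction with
      | empty =>
        ext n
        simp [coeff_hasseSeries]
      | cons i t hi ih =>
        rw [Finset.sum_cons, Finset.sum_cons, hasseSeries_add, ih, ← smul_eq_C_mul,
          hasseSeries_smul, smul_eq_C_mul]
    exact hadd _
  have hdet : C m.det = ((C (R := k)).mapMatrix m).transpose.det := by
    rw [Matrix.det_transpose, ← RingHom.map_det]
  have hcol := Matrix.det_mul_column
    (Matrix.vecCons 1 (Matrix.vecCons 1 fun s => (X : k⟦X⟧) ^ κ s))
    (Matrix.of (Matrix.vecCons (fun i => φ i ^ a)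
      (Matrix.vecCons (fun i => φ i ^ b) (fun s i => hasseSeries (κ s) (φ i)))))
  rw [Fin.prod_univ_succ, Fin.prod_univ_succ] at hcol
  simp only [Matrix.cons_val_zero, Matrix.cons_val_succ, one_mul,
    Finset.prod_pow_eq_pow_sum] at hcol
  rw [← hcol, hdet, ← Matrix.det_mul]
  congr 1
  ext1 s c
  rw [Matrix.mul_apply]
  refine Fin.cases ?_ (fun s => Fin.cases ?_ (fun s => ?_) s) s
  · simp [mul_comm]
  · simp [mul_comm]
  · simp only [Matrix.of_apply, Matrix.cons_val_succ, Matrix.transpose_apply, hlin, Finset.mul_sum,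
      RingHom.mapMatrix_apply, Matrix.map_apply]
    exact Finset.sum_congr rfl fun i _ => by ring

end Determinant

/-! ### Sums of orders over the remaining columns -/

section Weights

variable {r : ℕ} {j : Fin (r + 2) → ℕ}

theorem sum_succAbove_succAbove (j : Fin (r + 2) → ℕ) (A : Fin (r + 2)) (B : Fin (r + 1)) :
    j A + (j (A.succAbove B) + ∑ i, j (A.succAbove (B.succAbove i))) = ∑ c, j c := by
  rw [Fin.sum_univ_succAbove j A, Fin.sum_univ_succAbove (fun i => j (A.succAbove i)) B]

theorem strictMono_succAbove_succAbove (A : Fin (r + 2)) (B : Fin (r + 1)) :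
    StrictMono fun i => A.succAbove (B.succAbove i) :=
  (Fin.strictMono_succAbove A).comp (Fin.strictMono_succAbove B)

theorem castSucc_castSucc_le {ε : Fin r → Fin (r + 2)} (hε : StrictMono ε) (i : Fin r) :
    i.castSucc.castSucc ≤ ε i := by
  rw [Fin.le_def]
  simp only [Fin.val_castSucc]
  obtain ⟨i, hi⟩ := i
  induction i with
  | zero => simp
  | succ i ih =>
    have h := ih (by omega)
    have hlt : ε ⟨i, by omega⟩ < ε ⟨i + 1, hi⟩ := hε (Fin.mk_lt_mk.2 i.lt_succ_self)
    rw [Fin.lt_def] at hlt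
    simp only at h ⊢
    omega

/-- The initial segment minimizes the sum of the orders. -/
theorem sum_initial_lt_or_eq (hj : StrictMono j) {ε : Fin r → Fin (r + 2)} (hε : StrictMono ε) :
    ∑ i : Fin r, j i.castSucc.castSucc < ∑ i, j (ε i) ∨
      ε = fun i => i.castSucc.castSucc := by
  have hle : ∀ i ∈ Finset.univ, j i.castSucc.castSucc ≤ j (ε i) :=
    fun i _ => hj.monotone (castSucc_castSucc_le hε i)
  rcases (Finset.sum_le_sum hle).lt_or_eq with h | h
  · exact Or.inl h
  · refine Or.inr (funext fun i => ?_)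
    exact (hj.injective ((Finset.sum_eq_sum_iff_of_le hle).1 h i (Finset.mem_univ i))).symm

end Weights

/-! ### Independence of combinations with distinct orders -/

section Orders

open PowerSeries

variable {k : Type*} [Field k] {r : ℕ}

theorem coeff_ne_zero_of_X_pow_dvd_iff {G : k⟦X⟧} {n : ℕ} (h : ∀ m, X ^ m ∣ G ↔ m ≤ n) :
    coeff n G ≠ 0 := by
  intro h0
  have h1 := (h n).2 le_rfl
  refine absurd ((h (n + 1)).1 ?_) (Nat.not_succ_le_self n)
  rw [X_pow_dvd_iff] at h1 ⊢
  intro m hm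
  rcases Nat.lt_succ_iff_lt_or_eq.1 hm with hm | rfl
  · exact h1 m hm
  · exact h0

/-- Linear combinations with pairwise distinct orders come from an invertible matrix. -/
theorem det_ne_zero_of_orders {n : ℕ} (φ : Fin n → k⟦X⟧) (m : Matrix (Fin n) (Fin n) k)
    (j : Fin n → ℕ) (hj : StrictMono j)
    (hm : ∀ c n, X ^ n ∣ ∑ i, C (m c i) * φ i ↔ n ≤ j c) : m.det ≠ 0 := by
  classical
  intro hdet
  obtain ⟨w, hw0, hw⟩ := Matrix.exists_vecMul_eq_zero_iff.2 hdet
  have hzero : ∑ c, C (w c) * ∑ i, C (m c i) * φ i = 0 := by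
    simp only [Finset.mul_sum]
    rw [Finset.sum_comm]
    refine Finset.sum_eq_zero fun i _ => ?_
    have hi := congrFun hw i
    simp only [Matrix.vecMul, dotProduct, Pi.zero_apply] at hi
    simp only [← mul_assoc, ← map_mul, ← Finset.sum_mul, ← map_sum]
    rw [hi, map_zero, zero_mul]
  obtain ⟨c₁, hc₁⟩ := Function.ne_iff.1 hw0
  have hne : (Finset.univ.filter fun c => w c ≠ 0).Nonempty := ⟨c₁, by simpa using hc₁⟩
  -- The least index in the support of a linear relation is the only one contributing to the
  -- coefficient of X^{j c₀}.
  set c₀ := (Finset.univ.filter fun c => w c ≠ 0).min' hne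
  have hc₀ : w c₀ ≠ 0 := (Finset.mem_filter.1 (Finset.min'_mem _ hne)).2
  have hcoeff := congrArg (coeff (j c₀)) hzero
  rw [map_sum, map_zero, Finset.sum_eq_single c₀] at hcoeff
  · rw [coeff_C_mul] at hcoeff
    exact mul_ne_zero hc₀ (coeff_ne_zero_of_X_pow_dvd_iff (hm c₀)) hcoeff
  · intro c _ hc
    rw [coeff_C_mul]
    by_cases hwc : w c = 0
    · rw [hwc, zero_mul]
    · have hlt : c₀ < c := lt_of_le_of_ne
        (Finset.min'_le _ _ (Finset.mem_filter.2 ⟨Finset.mem_univ c, hwc⟩)) hc.symm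
      rw [X_pow_dvd_iff.1 ((hm c (j c)).2 le_rfl) _ (hj hlt), mul_zero]
  · simp

end Orders

/-! ### Order bounds for the three kinds of points -/

section Bounds

open PowerSeries

variable {k : Type*} [Field k] {r : ℕ} {x y G : Fin (r + 2) → k⟦X⟧} {j : Fin (r + 2) → ℕ}
  {κ : Fin r → ℕ}

/-- The lower bound at a general point, with a factor `X ^ e` in the first row. -/
theorem X_pow_dvd_det_general (hj : StrictMono j) (hG : ∀ c, X ^ j c ∣ G c) {e : ℕ}
    (hx : ∀ c, X ^ e ∣ x c) :
    X ^ (e + ∑ i : Fin r, j i.castSucc.castSucc) ∣ Matrix.det (Matrix.of (Matrix.vecCons x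
      (Matrix.vecCons y fun s c => X ^ κ s * hasseSeries (κ s) (G c)))) ∧
    (((binomDet (fun i : Fin r => j i.castSucc.castSucc) κ : ℤ) : k) = 0 →
      X ^ (e + ∑ i : Fin r, j i.castSucc.castSucc + 1) ∣ Matrix.det (Matrix.of (Matrix.vecCons x
      (Matrix.vecCons y fun s c => X ^ κ s * hasseSeries (κ s) (G c))))) := by
  constructor
  · refine X_pow_dvd_det (α := fun _ => e) (β := fun _ => 0) κ hx (fun c => by simp) hG
      fun A B => Or.inl ?_
    rcases sum_initial_lt_or_eq hj (strictMono_succAbove_succAbove A B) with h | h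
    · omega
    · rw [show (∑ i, j (A.succAbove (B.succAbove i))) = ∑ i : Fin r, j i.castSucc.castSucc from
        Finset.sum_congr rfl fun i _ => congrArg j (congrFun h i)]
      omega
  · intro h0
    refine X_pow_dvd_det (α := fun _ => e) (β := fun _ => 0) κ hx (fun c => by simp) hG
      fun A B => ?_
    rcases sum_initial_lt_or_eq hj (strictMono_succAbove_succAbove A B) with h | h
    · left; omega
    · right
      have h' : ∀ i, j (A.succAbove (B.succAbove i)) = j i.castSucc.castSucc := fun i =>
        congrArg j (congrFun h i)
      simp only [h']
      exact ⟨by omega, h0⟩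

/-- If the Frobenius row of known order uses column a and the other row uses column b, the term has
weight at least Σ j + (Q − 1) j_a − j_b. As j_0 = 0 and Q ≥ 2, the minimum is reached only for a = 0
and b the last column. -/
theorem X_pow_dvd_det_middle (hj : StrictMono j) (hj0 : j 0 = 0) (hG : ∀ c, X ^ j c ∣ G c) {Q : ℕ}
    (hQ : 2 ≤ Q) (h : (∀ c, X ^ (Q * j c) ∣ x c) ∨ (∀ c, X ^ (Q * j c) ∣ y c)) :
    X ^ (∑ i : Fin r, j i.succ.castSucc) ∣ Matrix.det (Matrix.of (Matrix.vecCons x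
      (Matrix.vecCons y fun s c => X ^ κ s * hasseSeries (κ s) (G c)))) ∧
    (((binomDet (fun i : Fin r => j i.succ.castSucc) κ : ℤ) : k) = 0 →
      X ^ (∑ i : Fin r, j i.succ.castSucc + 1) ∣ Matrix.det (Matrix.of (Matrix.vecCons x
      (Matrix.vecCons y fun s c => X ^ κ s * hasseSeries (κ s) (G c))))) := by
  have hS : j 0 + (j (Fin.last (r + 1)) + ∑ i : Fin r, j i.succ.castSucc) = ∑ c, j c := by
    rw [Fin.sum_univ_succ, Fin.sum_univ_castSucc]
    simp only [Fin.succ_castSucc, Fin.succ_last, Nat.succ_eq_add_one]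
    omega
  have hlast : ∀ c, c ≠ Fin.last (r + 1) → j c < j (Fin.last (r + 1)) := fun c hc =>
    hj (Fin.lt_last_iff_ne_last.2 hc)
  have hpos : ∀ c, c ≠ 0 → 0 < j c := fun c hc => by
    rw [← hj0]; exact hj (Fin.pos_iff_ne_zero.2 hc)
  rcases h with hx | hy
  · have hw : ∀ (A : Fin (r + 2)) (B : Fin (r + 1)),
        ∑ i : Fin r, j i.succ.castSucc
          < Q * j A + 0 + ∑ i, j (A.succAbove (B.succAbove i)) ∨
        ∀ i, A.succAbove (B.succAbove i) = i.succ.castSucc := by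
      intro A B
      have hsum := sum_succAbove_succAbove j A B
      by_cases hA : A = 0
      · subst hA
        by_cases hB : B = Fin.last r
        · right
          intro i
          rw [hB, Fin.succAbove_last, Fin.zero_succAbove, Fin.succ_castSucc]
        · left
          have := hlast ((0 : Fin (r + 2)).succAbove B) (by
            rw [Fin.zero_succAbove, ← Fin.succ_last]
            exact fun h => hB (Fin.succ_injective _ h))
          omega
      · left
        have h1 := hpos A hA
        have h2 : j (A.succAbove B) ≤ j (Fin.last (r + 1)) := hj.monotone (Fin.le_last _)
        have h3 : 2 * j A ≤ Q * j A := Nat.mul_le_mul_right _ hQ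
        omega
    constructor
    · refine X_pow_dvd_det (α := fun c => Q * j c) (β := fun _ => 0) κ hx (fun c => by simp) hG
        fun A B => Or.inl ?_
      rcases hw A B with h | h
      · exact h.le
      · simp only [h]
        omega
    · intro h0
      refine X_pow_dvd_det (α := fun c => Q * j c) (β := fun _ => 0) κ hx (fun c => by simp) hG
        fun A B => ?_
      rcases hw A B with h | h
      · exact Or.inl h
      · right
        simp only [h]
        exact ⟨by omega, h0⟩
  · have hw : ∀ (A : Fin (r + 2)) (B : Fin (r + 1)),
        ∑ i : Fin r, j i.succ.castSucc
          < 0 + Q * j (A.succAbove B) + ∑ i, j (A.succAbove (B.succAbove i)) ∨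
        ∀ i, A.succAbove (B.succAbove i) = i.succ.castSucc := by
      intro A B
      have hsum := sum_succAbove_succAbove j A B
      by_cases hB : A.succAbove B = 0
      · by_cases hA : A = Fin.last (r + 1)
        · right
          intro i
          subst hA
          rw [Fin.succAbove_last] at hB
          have hB0 : B = 0 := Fin.castSucc_eq_zero_iff.1 hB
          rw [hB0, Fin.succAbove_last, Fin.zero_succAbove]
        · left
          have := hlast A hA
          rw [hB] at hsum ⊢
          omega
      · left
        have h1 := hpos _ hB
        have h2 : j A ≤ j (Fin.last (r + 1)) := hj.monotone (Fin.le_last _)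
        have h3 : 2 * j (A.succAbove B) ≤ Q * j (A.succAbove B) := Nat.mul_le_mul_right _ hQ
        omega
    constructor
    · refine X_pow_dvd_det (α := fun _ => 0) (β := fun c => Q * j c) κ (fun c => by simp) hy hG
        fun A B => Or.inl ?_
      rcases hw A B with h | h
      · exact h.le
      · simp only [h]
        omega
    · intro h0
      refine X_pow_dvd_det (α := fun _ => 0) (β := fun c => Q * j c) κ (fun c => by simp) hy hG
        fun A B => ?_
      rcases hw A B with h | h
      · exact Or.inl h
      · right
        simp only [h]
        exact ⟨by omega, h0⟩

/-- Both Frobenius rows have exact orders and the weight has a unique minimizer, columns 0 and 1. No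
cancellation can occur at lowest order, so one binomial determinant decides equality. -/
theorem X_pow_dvd_det_rational (hj : StrictMono j) (hj0 : j 0 = 0)
    (hG : ∀ c n, X ^ n ∣ G c ↔ n ≤ j c) {Q Q' : ℕ} (hQ : 2 ≤ Q) (hQQ : Q < Q')
    (hx : ∀ c n, X ^ n ∣ x c ↔ n ≤ Q' * j c) (hy : ∀ c n, X ^ n ∣ y c ↔ n ≤ Q * j c) :
    X ^ (j 1 * Q + ∑ i : Fin r, j i.succ.succ) ∣ Matrix.det (Matrix.of (Matrix.vecCons x
      (Matrix.vecCons y fun s c => X ^ κ s * hasseSeries (κ s) (G c)))) ∧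
    (X ^ (j 1 * Q + ∑ i : Fin r, j i.succ.succ + 1) ∣ Matrix.det (Matrix.of (Matrix.vecCons x
      (Matrix.vecCons y fun s c => X ^ κ s * hasseSeries (κ s) (G c)))) ↔
      ((binomDet (fun i : Fin r => j i.succ.succ) κ : ℤ) : k) = 0) := by
  have hx' := fun c => (hx c _).2 le_rfl
  have hy' := fun c => (hy c _).2 le_rfl
  have hG' := fun c => (hG c _).2 le_rfl
  have hpos : ∀ c, c ≠ 0 → 0 < j c := fun c hc => by
    rw [← hj0]; exact hj (Fin.pos_iff_ne_zero.2 hc)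
  have hone : ∀ c, c ≠ 0 → j 1 ≤ j c := fun c hc => hj.monotone (Fin.one_le_of_ne_zero hc)
  have h00 : ∀ i : Fin r, (0 : Fin (r + 2)).succAbove ((0 : Fin (r + 1)).succAbove i)
      = i.succ.succ := fun i => by rw [Fin.zero_succAbove, Fin.zero_succAbove]
  have h01 : (0 : Fin (r + 2)).succAbove (0 : Fin (r + 1)) = 1 := by
    rw [Fin.zero_succAbove, Fin.succ_zero_eq_one]
  have hS : j 0 + (j 1 + ∑ i : Fin r, j i.succ.succ) = ∑ c, j c := by
    rw [Fin.sum_univ_succ, Fin.sum_univ_succ]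
    rfl
  have hw : ∀ (A : Fin (r + 2)) (B : Fin (r + 1)), ¬ (A = 0 ∧ B = 0) →
      j 1 * Q + ∑ i : Fin r, j i.succ.succ + 1
        ≤ Q' * j A + Q * j (A.succAbove B) + ∑ i, j (A.succAbove (B.succAbove i)) := by
    intro A B hAB
    have hsum := sum_succAbove_succAbove j A B
    -- With Q = R + 1 and Q' = R' + 1 the weight is Σ j + R'·j_a + R·j_b, to be compared with Σ j +
    -- R·j_1.
    obtain ⟨R, rfl⟩ : ∃ R, Q = R + 1 := ⟨Q - 1, by omega⟩
    obtain ⟨R', rfl⟩ : ∃ R', Q' = R' + 1 := ⟨Q' - 1, by omega⟩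
    by_cases hA : A = 0
    · subst hA
      have hB : B ≠ 0 := fun h => hAB ⟨rfl, h⟩
      have h1 : j 1 < j ((0 : Fin (r + 2)).succAbove B) := by
        refine hj ?_
        rw [← h01]
        exact Fin.strictMono_succAbove 0 (Fin.pos_iff_ne_zero.2 hB)
      have h2 : R * j 1 < R * j ((0 : Fin (r + 2)).succAbove B) :=
        Nat.mul_lt_mul_of_pos_left h1 (by omega)
      rw [mul_comm (j 1), add_mul, add_mul, add_mul]
      omega
    · have h1 := hone A hA
      have h2 := hpos A hA
      have h3 : R * j 1 ≤ R * j A := Nat.mul_le_mul_left _ h1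
      have h4 : R * j A < R' * j A := Nat.mul_lt_mul_of_pos_right (by omega) h2
      rw [mul_comm (j 1), add_mul, add_mul, add_mul]
      have h5 := Nat.zero_le (R * j (A.succAbove B))
      omega
  have hw0 : j 1 * Q + ∑ i : Fin r, j i.succ.succ
      = Q' * j 0 + Q * j 1 + ∑ i : Fin r, j i.succ.succ := by
    rw [hj0, mul_comm]
    simp
  have hweak : ∀ N, N ≤ j 1 * Q + ∑ i : Fin r, j i.succ.succ + 1 →
      (N ≤ j 1 * Q + ∑ i : Fin r, j i.succ.succ ∨
        ((binomDet (fun i : Fin r => j i.succ.succ) κ : ℤ) : k) = 0) →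
      X ^ N ∣ Matrix.det (Matrix.of (Matrix.vecCons x
        (Matrix.vecCons y fun s c => X ^ κ s * hasseSeries (κ s) (G c)))) := by
    intro N hN hor
    refine X_pow_dvd_det (α := fun c => Q' * j c) (β := fun c => Q * j c) κ hx' hy' hG'
      fun A B => ?_
    by_cases hAB : A = 0 ∧ B = 0
    · obtain ⟨rfl, rfl⟩ := hAB
      simp only [h00, h01]
      rw [← hw0]
      rcases hor with h | h
      · exact Or.inl h
      · exact Or.inr ⟨hN, h⟩
    · exact Or.inl (hN.trans (hw A B hAB))
  refine ⟨hweak _ (Nat.le_succ _) (Or.inl le_rfl), fun hdvd => ?_,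
    fun h0 => hweak _ le_rfl (Or.inr h0)⟩
  by_contra hb
  exact not_X_pow_dvd_det (α := fun c => Q' * j c) (β := fun c => Q * j c) κ hx' hy' hG' hw0 hw
    (coeff_ne_zero_of_X_pow_dvd_iff (hx 0)) (coeff_ne_zero_of_X_pow_dvd_iff (hy 1))
    (fun c => coeff_ne_zero_of_X_pow_dvd_iff (hG c)) hb hdvd

end Bounds

/-! ### From power series back to the Frobenius divisor -/

namespace Place

section Assemble

open PowerSeries

variable {k K : Type*} [Field k] [Field K] [Algebra k K] {P : Place k K}
  (hres : ∀ x, 0 ≤ P.v x → ∃ c : k, 0 < P.v (x - algebraMap k K c))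

theorem X_pow_dvd_sum_expand_iff {ι : Type*} [Fintype ι] (b : ι → k) (y : ι → P.valRing)
    (a n : ℕ) : X ^ n ∣ ∑ i, C (b i) * expand hres (y i) ^ a ↔
      (n : WithTop ℤ) ≤ P.v (∑ i, algebraMap k K (b i) * (y i : K) ^ a) := by
  let z : P.valRing :=
    ∑ i, (⟨algebraMap k K (b i), P.zero_le_v_algebraMap _⟩ : P.valRing) * y i ^ a
  have h : expand hres z = ∑ i, C (b i) * expand hres (y i) ^ a := by
    rw [map_sum]
    refine Finset.sum_congr rfl fun i _ => ?_
    rw [map_mul, map_pow]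
    congr 1
    exact expand_algebraMap hres (b i) _
  rw [← h, X_pow_dvd_expand_iff]
  simp [z]

theorem sum_single_sub_single {R ι : Type*} [CommRing R] [Fintype ι] [DecidableEq ι] (H : k →+* R)
    (z : ι → R) (i i₀ : ι) (c : k) :
    ∑ l, H ((Pi.single i 1 - Pi.single i₀ c : ι → k) l) * z l = z i - H c * z i₀ := by
  have h : ∀ (i : ι) (a : k), ∑ l, H ((Pi.single i a : ι → k) l) * z l = H a * z i := by
    intro i a
    rw [Finset.sum_eq_single i]
    · rw [Pi.single_eq_same]
    · intro l _ hl
      rw [Pi.single_eq_of_ne hl, map_zero, zero_mul]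
    · simp
  simp only [Pi.sub_apply, map_sub, sub_mul, Finset.sum_sub_distrib, h, map_one, one_mul]

theorem baseOrder_eq {ι : Type*} [Fintype ι] (f : ι → K) (i₀ : ι)
    (hi₀ : ∀ i, P.v (f i₀) ≤ P.v (f i)) : baseOrder f P = - P.ord (f i₀) := by
  have : (Finset.univ.inf fun i => P.v (f i)) = P.v (f i₀) :=
    le_antisymm (Finset.inf_le (Finset.mem_univ i₀)) (Finset.le_inf fun i _ => hi₀ i)
  rw [baseOrder, this, ord]

/-- The factor (dt/ds)^{Σκ} accounts for the term in div(dt), and the power of `(f i₀)⁻¹` for the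
term in E. -/
theorem X_pow_dvd_expandDet_iff {F L : Type*} [Field F] [Field L] [Algebra F k] [Algebra F L]
    [Algebra F K] [Algebra L K] [IsScalarTower F k K] [IsScalarTower F L K]
    [Algebra.IsPushout F k L K] {t : L} (ht : IsSeparatingVariable F t) {q u m r : ℕ} (hr : 1 ≤ r)
    (f : Fin (r + 2) → K) (κ : Fin r → ℕ)
    (hκ : IsFrobeniusOrderSeq k q u m (algebraMap L K t) f κ) (i₀ : Fin (r + 2))
    (hf₀ : f i₀ ≠ 0) (hi₀ : ∀ i, P.v (f i₀) ≤ P.v (f i))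
    (hg : ∀ i, (f i₀)⁻¹ * f i ∈ P.valRing) (N : ℕ) :
    X ^ N ∣ Matrix.det (Matrix.of
      (Matrix.vecCons (fun i => expand hres ⟨(f i₀)⁻¹ * f i, hg i⟩ ^ q ^ m)
        (Matrix.vecCons (fun i => expand hres ⟨(f i₀)⁻¹ * f i, hg i⟩ ^ q ^ u)
          (fun (s : Fin r) (i : Fin (r + 2)) =>
            hasseSeries (κ s) (expand hres ⟨(f i₀)⁻¹ * f i, hg i⟩))))) ↔
      (N : ℤ) ≤ frobeniusDivisor q u m (algebraMap L K t) f κ P := by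
  obtain ⟨⟨hmono, hne⟩, hleast⟩ := hκ
  have hD := isHasseSystem_of_frobeniusDet_ne_zero hr hne
  have hdet := algebraMap_det_expand hres ht hD (q ^ m) (q ^ u) f κ hmono ?_ (f i₀)⁻¹ hg
  · have hs := hasse_one_uniformizer_ne_zero hres ht hD
    rw [ord_eq_of_toLaurent_eq hres (mul_ne_zero hne (mul_ne_zero
      (pow_ne_zero _ (inv_ne_zero hs)) (pow_ne_zero _ (inv_ne_zero hf₀)))) hdet.symm,
      P.ord_mul hne (mul_ne_zero (pow_ne_zero _ (inv_ne_zero hs))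
        (pow_ne_zero _ (inv_ne_zero hf₀))),
      P.ord_mul (pow_ne_zero _ (inv_ne_zero hs)) (pow_ne_zero _ (inv_ne_zero hf₀)),
      P.ord_pow (inv_ne_zero hs), P.ord_pow (inv_ne_zero hf₀), P.ord_inv hf₀,
      frobeniusDivisor, ordDiff_eq hres ht hD, baseOrder_eq f i₀ hi₀, add_assoc]
    push_cast
    rw [ofLex_toLex]
    constructor <;> intro h <;> linarith
  · intro ρ hρ hle hneq
    by_contra h0
    -- A sequence dominated by κ pointwise and distinct from it is lexicographically smaller.
    have hlt : toLex ρ < toLex κ := Pi.toLex_strictMono (lt_of_le_of_ne hle hneq)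
    exact absurd (hleast (show toLex ρ ∈ _ from ⟨hρ, h0⟩)) (not_le.2 hlt)

/-- The functions `φ` vanish to order at least `e` away from constants fixed by the `Q`-th power
map, hence so do the differences of their powers. -/
theorem X_pow_dvd_pow_sub_pow {F : Type*} [Field F] [Finite F] [Algebra F k] {φ : k⟦X⟧} {c : k}
    {e u m : ℕ} (hum : u ≤ m) (hc : c ^ (Nat.card F ^ (m - u)) = c)
    (h : X ^ e ∣ φ - C c) :
    X ^ (e * Nat.card F ^ u) ∣ φ ^ (Nat.card F ^ m) - φ ^ (Nat.card F ^ u) := by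
  let := Fintype.ofFinite F
  have h1 : φ ^ (Nat.card F ^ (m - u)) - φ
      = (φ - C c) ^ (Nat.card F ^ (m - u)) - (φ - C c) := by
    rw [← frobenius_pow_apply (F := F) (m - u) (φ - C c), map_sub, frobenius_pow_apply,
      frobenius_pow_apply, ← map_pow, hc]
    ring
  have h2 : φ ^ (Nat.card F ^ m) - φ ^ (Nat.card F ^ u)
      = (φ ^ (Nat.card F ^ (m - u)) - φ) ^ (Nat.card F ^ u) := by
    rw [← frobenius_pow_apply (F := F) u (φ ^ (Nat.card F ^ (m - u)) - φ), map_sub,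
      frobenius_pow_apply, frobenius_pow_apply, ← pow_mul, ← pow_add, Nat.sub_add_cancel hum]
  rw [h2, h1, pow_mul]
  refine pow_dvd_pow_of_dvd (dvd_sub (h.trans (dvd_pow_self _ ?_)) h) _
  exact (pow_pos Nat.card_pos _).ne'

theorem X_pow_dvd_sum_pow_iff_of_isRational {F L : Type*} [Field F] [Finite F] [Field L]
    [Algebra F k] [Algebra F L] [Algebra F K] [Algebra L K] [IsScalarTower F k K]
    [IsScalarTower F L K] [Algebra.IsPushout F k L K] [IsAlgClosed k] [Algebra.IsAlgebraic F k]
    {d : ℕ} (hrat : P.IsRational F L d) {ι : Type*} [Fintype ι] (b : ι → k) (f : ι → L)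
    (hf : ∀ i, algebraMap L K (f i) ∈ P.valRing) {e : ℕ}
    (he : P.v (∑ i, algebraMap k K (b i) * algebraMap L K (f i)) = (e : ℤ)) (n : ℕ) :
    X ^ n ∣ ∑ i, C (b i) * expand hres ⟨algebraMap L K (f i), hf i⟩ ^ (Nat.card F ^ d) ↔
      n ≤ Nat.card F ^ d * e := by
  rw [X_pow_dvd_sum_expand_iff]
  simp only
  have hne : ∑ i, algebraMap k K (b i) * algebraMap L K (f i) ≠ 0 := by
    intro h
    rw [h, AddValuation.map_zero] at he
    exact absurd he (by simp)
  rw [v_sum_pow_of_isRational hres hrat, P.v_eq_ord (pow_ne_zero _ hne), P.ord_pow hne]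
  rw [P.v_eq_ord hne] at he
  have he' : P.ord (∑ i, algebraMap k K (b i) * algebraMap L K (f i)) = e := by exact_mod_cast he
  rw [he']
  norm_cast

end Assemble

end Place

end

end FrobeniusDivisor

/-- Here `F = 𝔽_q`, `k` is its algebraic closure, `L = 𝔽_q(𝒳)`, `K = k ⊗ L = k(𝒳)`, and the
morphism `(f_0 : ⋯ : f_n)` into projective `n`-space has `n = r + 1 ≥ 2`. -/
theorem proposition4p1
    {F k L K : Type*} [Field F] [Finite F] [Field k] [Field L] [Field K]
    [Algebra F k] [IsAlgClosure F k] [Algebra F L] [Algebra F K] [Algebra k K] [Algebra L K]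
    [IsScalarTower F k K] [IsScalarTower F L K] [Algebra.IsPushout F k L K]
    (p : ℕ) [CharP F p] (q : ℕ) (hq : q = Nat.card F)
    (hL : FrobeniusDivisor.IsFunctionFieldOneVar F L)
    (u m : ℕ) (hu : 1 ≤ u) (hum : u < m) (hcop : Nat.Coprime u m)
    (r : ℕ) (hr : 1 ≤ r)
    (f : Fin (r + 2) → L) (hf : LinearIndependent k fun i => algebraMap L K (f i))
    (t : L) (ht : FrobeniusDivisor.IsSeparatingVariable F t)
    (κ : Fin r → ℕ)
    (hκ : FrobeniusDivisor.IsFrobeniusOrderSeq k q u m (algebraMap L K t)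
      (fun i => algebraMap L K (f i)) κ)
    (P : FrobeniusDivisor.Place k K) (j : Fin (r + 2) → ℕ)
    (hj : FrobeniusDivisor.IsOrderSeqAt (fun i => algebraMap L K (f i)) P j)
    (T : FrobeniusDivisor.Place k K → ℤ)
    (hT : T = FrobeniusDivisor.frobeniusDivisor q u m (algebraMap L K t)
      (fun i => algebraMap L K (f i)) κ) :
    -- rational points over `𝔽_q`
    (P.IsRational F L 1 →
      (j 1 : ℤ) * q ^ u + ∑ i : Fin r, ((j i.succ.succ : ℤ) - κ i) ≤ T P ∧
      (T P = (j 1 : ℤ) * q ^ u + ∑ i : Fin r, ((j i.succ.succ : ℤ) - κ i) ↔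
        ¬ (p : ℤ) ∣ FrobeniusDivisor.binomDet (fun i : Fin r => j i.succ.succ) κ)) ∧
    -- rational points over `𝔽_{q^{m-u}}`
    (P.IsRational F L (m - u) →
      (j 1 : ℤ) * q ^ u + ∑ i : Fin r, ((j i.castSucc.castSucc : ℤ) - κ i) ≤ T P ∧
      ((p : ℤ) ∣ FrobeniusDivisor.binomDet (fun i : Fin r => j i.castSucc.castSucc) κ →
        (j 1 : ℤ) * q ^ u + ∑ i : Fin r, ((j i.castSucc.castSucc : ℤ) - κ i) < T P)) ∧
    -- rational points over `𝔽_{q^u}` or `𝔽_{q^m}`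
    (P.IsRational F L u ∨ P.IsRational F L m →
      ∑ i : Fin r, ((j i.succ.castSucc : ℤ) - κ i) ≤ T P ∧
      ((p : ℤ) ∣ FrobeniusDivisor.binomDet (fun i : Fin r => j i.succ.castSucc) κ →
        ∑ i : Fin r, ((j i.succ.castSucc : ℤ) - κ i) < T P)) ∧
    -- arbitrary points
    (∑ i : Fin r, ((j i.castSucc.castSucc : ℤ) - κ i) ≤ T P ∧
      ((p : ℤ) ∣ FrobeniusDivisor.binomDet (fun i : Fin r => j i.castSucc.castSucc) κ →
        ∑ i : Fin r, ((j i.castSucc.castSucc : ℤ) - κ i) < T P)) := by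
  have : IsAlgClosed k := IsAlgClosure.isAlgClosed F
  have : Algebra.IsAlgebraic F k := IsAlgClosure.isAlgebraic
  have : CharP k p := charP_of_injective_algebraMap (algebraMap F k).injective p
  have htr : Algebra.trdeg k K ≤ 1 := FrobeniusDivisor.trdeg_le_one_of_isSeparatingVariable ht
  have hres : ∀ x, 0 ≤ P.v x → ∃ c : k, 0 < P.v (x - algebraMap k K c) :=
    fun x hx => P.exists_residue htr hx
  have hf0 : ∀ i, algebraMap L K (f i) ≠ 0 := fun i => hf.ne_zero i
  -- Dividing by a coordinate of least valuation makes all coordinates regular at P and one of them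
  -- equal to 1; valuations of combinations become the orders of the linear series.
  obtain ⟨i₀, hi₀⟩ := Finite.exists_min fun i => P.v (algebraMap L K (f i))
  have hbase := FrobeniusDivisor.Place.baseOrder_eq (P := P) (fun i => algebraMap L K (f i)) i₀ hi₀
  have hg0 : (algebraMap L K (f i₀))⁻¹ ≠ 0 := inv_ne_zero (hf0 i₀)
  have hgord : P.ord (algebraMap L K (f i₀))⁻¹
      = FrobeniusDivisor.baseOrder (fun i => algebraMap L K (f i)) P := by
    rw [hbase, P.ord_inv (hf0 i₀)]
  have hg : ∀ i, (algebraMap L K (f i₀))⁻¹ * algebraMap L K (f i) ∈ P.valRing := by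
    intro i
    have h := hi₀ i
    rw [P.v_eq_ord (hf0 i₀), P.v_eq_ord (hf0 i)] at h
    have h' : P.ord (algebraMap L K (f i₀)) ≤ P.ord (algebraMap L K (f i)) := by exact_mod_cast h
    rw [FrobeniusDivisor.Place.mem_valRing, P.v_eq_ord (mul_ne_zero hg0 (hf0 i)),
      P.ord_mul hg0 (hf0 i), hgord, hbase]
    have : (0 : ℤ) ≤ -P.ord (algebraMap L K (f i₀)) + P.ord (algebraMap L K (f i)) := by omega
    exact_mod_cast this
  have hTdvd := FrobeniusDivisor.Place.X_pow_dvd_expandDet_iff hres ht hr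
    (fun i => algebraMap L K (f i)) κ hκ i₀ (hf0 i₀) hi₀ hg
  rw [← hT] at hTdvd
  set φ : Fin (r + 2) → PowerSeries k := fun i => FrobeniusDivisor.Place.expand hres
    ⟨(algebraMap L K (f i₀))⁻¹ * algebraMap L K (f i), hg i⟩ with hφ
  have hcomb : ∀ b : Fin (r + 2) → k, ∑ i, algebraMap k K (b i) *
      ((algebraMap L K (f i₀))⁻¹ * algebraMap L K (f i))
      = (algebraMap L K (f i₀))⁻¹ * ∑ i, b i • algebraMap L K (f i) := by
    intro b
    rw [Finset.mul_sum]
    refine Finset.sum_congr rfl fun i _ => ?_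
    rw [Algebra.smul_def]
    ring
  have hlin : ∀ (b : Fin (r + 2) → k) (n : ℕ),
      PowerSeries.X ^ n ∣ ∑ i, PowerSeries.C (b i) * φ i ↔
      (n : WithTop ℤ) ≤ P.v ((algebraMap L K (f i₀))⁻¹ * ∑ i, b i • algebraMap L K (f i)) := by
    intro b n
    have h := FrobeniusDivisor.Place.X_pow_dvd_sum_expand_iff hres b (fun i => ⟨_, hg i⟩) 1 n
    simp only [pow_one] at h
    rw [h, hcomb]
  have hS0 : ∀ b : Fin (r + 2) → k, b ≠ 0 →
      (algebraMap L K (f i₀))⁻¹ * ∑ i, b i • algebraMap L K (f i) ≠ 0 := fun b hb =>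
    mul_ne_zero hg0 fun h => hb (funext (Fintype.linearIndependent_iff.1 hf b h))
  have hord : ∀ b : Fin (r + 2) → k, b ≠ 0 →
      P.ord ((algebraMap L K (f i₀))⁻¹ * ∑ i, b i • algebraMap L K (f i))
        = P.ord (∑ i, b i • algebraMap L K (f i))
          + FrobeniusDivisor.baseOrder (fun i => algebraMap L K (f i)) P := by
    intro b hb
    rw [P.ord_mul hg0 (right_ne_zero_of_mul (hS0 b hb)), hgord, add_comm]
  obtain ⟨hjmono, hjrange⟩ := hj
  have hrange : ∀ b : Fin (r + 2) → k, b ≠ 0 → ∃ c, (j c : ℤ)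
      = P.ord ((algebraMap L K (f i₀))⁻¹ * ∑ i, b i • algebraMap L K (f i)) := by
    intro b hb
    have h : P.ord ((algebraMap L K (f i₀))⁻¹ * ∑ i, b i • algebraMap L K (f i))
        ∈ Set.range fun i => (j i : ℤ) := by
      rw [hjrange]
      exact ⟨_, ⟨b, hb, rfl⟩, (hord b hb).symm⟩
    exact h
  have hex : ∀ c, ∃ b : Fin (r + 2) → k, b ≠ 0 ∧
      P.ord ((algebraMap L K (f i₀))⁻¹ * ∑ i, b i • algebraMap L K (f i)) = j c := by
    intro c
    have h : (j c : ℤ) ∈ Set.range fun i => (j i : ℤ) := ⟨c, rfl⟩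
    rw [hjrange] at h
    obtain ⟨_, ⟨b, hb, rfl⟩, h⟩ := h
    exact ⟨b, hb, (hord b hb).trans h⟩
  -- The rows of `b` are combinations realizing the orders j_c; having distinct orders, they form an
  -- invertible matrix.
  choose b hb0 hb using hex
  have hbv : ∀ c, P.v ((algebraMap L K (f i₀))⁻¹ * ∑ i, b c i • algebraMap L K (f i))
      = ((j c : ℤ) : WithTop ℤ) := fun c => by
    rw [P.v_eq_ord (hS0 _ (hb0 c)), hb]
  have hG : ∀ c n, PowerSeries.X ^ n ∣ ∑ i, PowerSeries.C (b c i) * φ i ↔ n ≤ j c := by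
    intro c n
    rw [hlin, hbv]
    norm_cast
  have hdet : (Matrix.of b).det ≠ 0 :=
    FrobeniusDivisor.det_ne_zero_of_orders φ (Matrix.of b) j hjmono hG
  have hj0 : j 0 = 0 := by
    have hsingle : (Pi.single i₀ 1 : Fin (r + 2) → k) ≠ 0 := by simp
    obtain ⟨c, hc⟩ := hrange _ hsingle
    have hone : ∑ i, (Pi.single i₀ 1 : Fin (r + 2) → k) i • algebraMap L K (f i)
        = algebraMap L K (f i₀) := by
      simp [Pi.single_apply]
    rw [hone, inv_mul_cancel₀ (hf0 i₀)] at hc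
    have h1 := P.ord_pow (hf0 i₀) 0
    simp only [pow_zero, Nat.cast_zero, zero_mul] at h1
    have := hjmono.monotone (Fin.zero_le c)
    omega
  have hTP : 0 ≤ T P := by simpa using (hTdvd 0).1 (by simp)
  -- The factors X^{κ_s} shift the order by Σκ, which accounts for the terms −κ_i in the bounds. For
  -- N ≤ Σκ both sides hold, the right one because T P ≥ 0.
  have hfin : ∀ N : ℕ, PowerSeries.X ^ N ∣ Matrix.det (Matrix.of
      (Matrix.vecCons (fun c => ∑ i, PowerSeries.C (b c i) * φ i ^ q ^ m)
        (Matrix.vecCons (fun c => ∑ i, PowerSeries.C (b c i) * φ i ^ q ^ u)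
          (fun s c => PowerSeries.X ^ κ s *
            FrobeniusDivisor.hasseSeries (κ s) (∑ i, PowerSeries.C (b c i) * φ i))))) ↔
      (N : ℤ) ≤ T P + ∑ s, (κ s : ℤ) := by
    intro N
    have hmul := FrobeniusDivisor.det_mul_eq (q ^ m) (q ^ u) κ φ (Matrix.of b)
    simp only [Matrix.of_apply] at hmul
    rw [← hmul, ((hdet.isUnit).map PowerSeries.C).dvd_mul_right]
    have hcast : ∑ s, (κ s : ℤ) = ((∑ s, κ s : ℕ) : ℤ) := by push_cast; rfl
    rw [hcast]
    rcases le_or_gt N (∑ s, κ s) with hN | hN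
    · refine iff_of_true ((pow_dvd_pow _ hN).mul_right _) ?_
      omega
    · obtain ⟨n, rfl⟩ := Nat.exists_eq_add_of_le hN.le
      rw [pow_add, mul_dvd_mul_iff_left (pow_ne_zero _ PowerSeries.X_ne_zero), hTdvd]
      push_cast
      omega
  have hbinom : ∀ z : ℤ, (p : ℤ) ∣ z ↔ (z : k) = 0 := fun z =>
    (CharP.intCast_eq_zero_iff k p z).symm
  have hsplit : ∀ e : Fin r → Fin (r + 2), ∑ i, ((j (e i) : ℤ) - κ i)
      = ((∑ i, j (e i) : ℕ) : ℤ) - ∑ i, (κ i : ℤ) := by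
    intro e
    push_cast
    rw [Finset.sum_sub_distrib]
  have hq2 : ∀ {d : ℕ}, d ≠ 0 → 2 ≤ q ^ d := fun hd => by
    rw [hq]
    exact Nat.one_lt_pow hd Finite.one_lt_card
  have hbase' : ∀ i, algebraMap L K ((f i₀)⁻¹ * f i)
      = (algebraMap L K (f i₀))⁻¹ * algebraMap L K (f i) := fun i => by
    rw [map_mul, map_inv₀]
  have hrow : ∀ d, P.IsRational F L d → ∀ c n,
      PowerSeries.X ^ n ∣ ∑ i, PowerSeries.C (b c i) * φ i ^ q ^ d ↔ n ≤ q ^ d * j c := by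
    intro d hd c n
    have h := FrobeniusDivisor.Place.X_pow_dvd_sum_pow_iff_of_isRational hres hd (b c)
      (fun i => (f i₀)⁻¹ * f i) (fun i => by rw [hbase']; exact hg i) (e := j c)
      (by simp only [hbase']; rw [hcomb, hbv]) n
    simp only [hbase', ← hq] at h
    exact h
  refine ⟨fun hrat => ?_, fun hrat => ?_, fun hrat => ?_, ?_⟩
  -- Constants fixed by the q-th power are fixed by all its iterates, so both Frobenius rows have
  -- known orders.
  · have hrat' : ∀ d, P.IsRational F L d := by
      intro d l hl
      obtain ⟨c, hc, hc'⟩ := hrat l hl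
      refine ⟨c, ?_, hc'⟩
      have := FrobeniusDivisor.pow_pow_mul_eq hc d
      rwa [one_mul] at this
    obtain ⟨h1, h2⟩ := FrobeniusDivisor.X_pow_dvd_det_rational (κ := κ) hjmono hj0 hG
      (hq2 (by omega : u ≠ 0)) (Nat.pow_lt_pow_right (hq2 one_ne_zero |>.trans_eq (pow_one q)) hum)
      (hrow m (hrat' m)) (hrow u (hrat' u))
    rw [hfin] at h1 h2
    rw [hsplit, hbinom, ← h2]
    push_cast at h1 ⊢
    constructor
    · linarith
    · constructor
      · intro h3 h4
        linarith
      · intro h3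
        push Not at h3
        linarith [Int.lt_add_one_iff.1 h3]
  -- As φ_{i₀} = 1, the difference φ_i − c is a combination of the φ's. It vanishes at P, so its
  -- order is some j_c other than j_0 = 0, hence at least j_1.
  · have hvan : ∀ i, ∃ c : k, c ^ (Nat.card F ^ (m - u)) = c ∧
        PowerSeries.X ^ j 1 ∣ φ i - PowerSeries.C c := by
      intro i
      obtain ⟨c, hc, hpos⟩ := hrat ((f i₀)⁻¹ * f i) (by rw [hbase']; exact hg i)
      refine ⟨c, hc, ?_⟩
      set w : Fin (r + 2) → k := Pi.single i 1 - Pi.single i₀ c with hw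
      have hwφ : ∑ i, PowerSeries.C (w i) * φ i = φ i - PowerSeries.C c := by
        have hone : φ i₀ = 1 := by
          simp only [hφ, inv_mul_cancel₀ (hf0 i₀)]
          exact map_one (FrobeniusDivisor.Place.expand hres)
        rw [hw, FrobeniusDivisor.Place.sum_single_sub_single, hone, mul_one]
      have hwv : (algebraMap L K (f i₀))⁻¹ * ∑ i, w i • algebraMap L K (f i)
          = algebraMap L K ((f i₀)⁻¹ * f i) - algebraMap k K c := by
        rw [← hcomb, hbase', hw]
        refine (FrobeniusDivisor.Place.sum_single_sub_single (algebraMap k K)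
          (fun i => (algebraMap L K (f i₀))⁻¹ * algebraMap L K (f i)) i i₀ c).trans ?_
        simp only [inv_mul_cancel₀ (hf0 i₀), mul_one]
      rw [← hwφ, hlin]
      -- The combination is trivial when i = i₀ and c = 1.
      by_cases hw0 : w = 0
      · simp [hw0]
      obtain ⟨c', hc'⟩ := hrange w hw0
      rw [← hwv, P.v_eq_ord (hS0 w hw0), ← hc'] at hpos
      rw [P.v_eq_ord (hS0 w hw0), ← hc']
      have hposj : 0 < j c' := by exact_mod_cast hpos
      have hle : j 1 ≤ j c' := hjmono.monotone (Fin.one_le_of_ne_zero fun h => by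
        rw [h, hj0] at hposj
        exact lt_irrefl 0 hposj)
      exact_mod_cast hle
    have hx : ∀ c, PowerSeries.X ^ (j 1 * q ^ u) ∣
        ((fun c => ∑ i, PowerSeries.C (b c i) * φ i ^ q ^ m)
          - fun c => ∑ i, PowerSeries.C (b c i) * φ i ^ q ^ u) c := by
      intro c
      rw [Pi.sub_apply, ← Finset.sum_sub_distrib]
      refine Finset.dvd_sum fun i _ => ?_
      obtain ⟨a, ha, hai⟩ := hvan i
      rw [← mul_sub, hq]
      exact (FrobeniusDivisor.Place.X_pow_dvd_pow_sub_pow hum.le ha hai).mul_left _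
    obtain ⟨h1, h2⟩ := FrobeniusDivisor.X_pow_dvd_det_general (κ := κ)
      (y := fun c => ∑ i, PowerSeries.C (b c i) * φ i ^ q ^ u)
      hjmono (fun c => (hG c _).2 le_rfl) hx
    -- Subtracting the second Frobenius row from the first leaves the determinant unchanged.
    rw [FrobeniusDivisor.det_vecCons_sub, hfin] at h1 h2
    rw [hsplit, hbinom]
    push_cast at h1 h2 ⊢
    exact ⟨by linarith, fun h3 => by linarith [h2 h3]⟩
  · have hmid : _ ∧ _ := hrat.elim
      (fun h => FrobeniusDivisor.X_pow_dvd_det_middle (κ := κ)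
        (x := fun c => ∑ i, PowerSeries.C (b c i) * φ i ^ q ^ m)
        (y := fun c => ∑ i, PowerSeries.C (b c i) * φ i ^ q ^ u)
        hjmono hj0 (fun c => (hG c _).2 le_rfl) (hq2 (by omega : u ≠ 0))
        (Or.inr fun c => (hrow u h c _).2 le_rfl))
      (fun h => FrobeniusDivisor.X_pow_dvd_det_middle (κ := κ)
        (x := fun c => ∑ i, PowerSeries.C (b c i) * φ i ^ q ^ m)
        (y := fun c => ∑ i, PowerSeries.C (b c i) * φ i ^ q ^ u)
        hjmono hj0 (fun c => (hG c _).2 le_rfl) (hq2 (by omega : m ≠ 0))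
        (Or.inl fun c => (hrow m h c _).2 le_rfl))
    obtain ⟨h1, h2⟩ := hmid
    rw [hfin] at h1 h2
    rw [hsplit, hbinom]
    push_cast at h1 h2 ⊢
    exact ⟨by linarith, fun h3 => by linarith [h2 h3]⟩
  · obtain ⟨h1, h2⟩ := FrobeniusDivisor.X_pow_dvd_det_general (κ := κ) (e := 0)
      (x := fun c => ∑ i, PowerSeries.C (b c i) * φ i ^ q ^ m)
      (y := fun c => ∑ i, PowerSeries.C (b c i) * φ i ^ q ^ u)
      hjmono (fun c => (hG c _).2 le_rfl) (fun c => by simp)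
    rw [hfin] at h1 h2
    rw [hsplit, hbinom]
    push_cast at h1 h2 ⊢
    exact ⟨by linarith, fun h3 => by linarith [h2 h3]⟩
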